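/- Let $\Omega\subseteq\mathbb R^d$ be open, let $f_1,\dots,f_\kappa:\Omega\to\mathbb R$ be real-analytic, let $A_1,\dots,A_\kappa\in\mathbb C^{n\times n}$, put $A(x)=f_1(x)A_1+\dots+f_\kappa(x)A_\kappa$, and let $\epsilon>0$. Let $\mathcal V$ be a subspace of $\mathbb C^n$. For a matrix $V$ whose columns form an orthonormal basis of $\mathcal V$ put $A^V(x)=A(x)V$. For $x\in\Omega$ and $z=(z_1,z_2)\in\mathbb R^2$, identified with $z_1+\mathrm i z_2\in\mathbb C$, let $$\sigma^{\mathcal V}(x,z)=\sigma_{\min}\big(A^V(x)-zV\big),\qquad \alpha_\epsilon^{\mathcal V}(x)=\max\{\operatorname{Re} z : \sigma^{\mathcal V}(x,z)\le\epsilon\},$$ which do not depend on the choice of $V$, and, for $y=(y_1,y_2,y_3)=(z_1,z_2,\mu)\in\mathbb R^3$, let $$\mathcal L^{\mathcal V}(x,y)=z_1-\mu\,(\sigma^{\mathcal V}(x,z)-\epsilon).$$ Call $x\in\Omega$ a nondegenerate point of the restriction of $A(\cdot)$ to $\mathcal V$ if (i) the problem of maximizing $z_1$ subject to $\sigma^{\mathcal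 V}(x,z)\le\epsilon$ has a unique optimal point $z^{\mathcal V}(x)$; (ii) for every $V$ as above, the smallest singular value of $A^V(x)-z^{\mathcal V}(x)V$ is simple; (iii) the problem has a Lagrange multiplier $\mu^{\mathcal V}(x)$ at $z^{\mathcal V}(x)$, that is, a number $\mu\ge 0$ such that $\mathcal L^{\mathcal V}_{z_1}=\mathcal L^{\mathcal V}_{z_2}=0$ at $(x,z^{\mathcal V}(x),\mu)$ and $\mu\,(\sigma^{\mathcal V}(x,z^{\mathcal V}(x))-\epsilon)=0$, and $\nabla^2_{yy}\mathcal L^{\mathcal V}(x,y^{\mathcal V}(x))$ is nonsingular, where $y^{\mathcal V}(x)=(z^{\mathcal V}(x),\mu^{\mathcal V}(x))$. Let $\widetilde x\in\Omega$ be a nondegenerate point of the restriction of $A(\cdot)$ to $\mathcal V$. Then the maximum $\alpha_\epsilon^{\mathcal V}(x)$ exists for all $x$ near $\widetilde x$, and $x\mapsto\alpha_\epsilon^{\mathcal V}(x)$ is real-analytic at $\widetilde x$. For every matrix $V$ whose columns form an orthonormal basis of $\mathcal V$ and every pair $u,v$ of consistent unit left and right singular vectors for $\sigma=\sigma^{\mathcal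 V}(\widetilde x,z^{\mathcal V}(\widetilde x))$, i.e. $\|u\|_2=\|v\|_2=1$, $(A^V(\widetilde x)-z^{\mathcal V}(\widetilde x)V)v=\sigma u$ and $u^*(A^V(\widetilde x)-z^{\mathcal V}(\widetilde x)V)=\sigma v^*$, one has $u^*Vv\neq0$, $$\frac{\partial\alpha_\epsilon^{\mathcal V}}{\partial x_j}(\widetilde x)=\operatorname{Re}\left(\frac{u^*\big[\frac{\partial A^V}{\partial x_j}(\widetilde x)\big]v}{u^*Vv}\right)\quad(j=1,\dots,d),\qquad \mu^{\mathcal V}(\widetilde x)=-\frac{1}{u^*Vv}.$$ Moreover, with all derivatives of $\mathcal L^{\mathcal V}$ evaluated at $(\widetilde x,y^{\mathcal V}(\widetilde x))$, $$\nabla^2\alpha_\epsilon^{\mathcal V}(\widetilde x)=\nabla^2_{xx}\mathcal L^{\mathcal V}-\nabla^2_{xy}\mathcal L^{\mathcal V}\,\big[\nabla^2_{yy}\mathcal L^{\mathcal V}\big]^{-1}\big[\nabla^2_{xy}\mathcal L^{\mathcal V}\big]^T,$$ where, with the derivatives of $\sigma^{\mathcal V}$ evaluated at $(\widetilde x,z^{\mathcal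 V}(\widetilde x))$ and $\mu=\mu^{\mathcal V}(\widetilde x)$, $[\nabla^2_{xx}\mathcal L^{\mathcal V}]_{j\ell}=-\mu\,\frac{\partial^2\sigma^{\mathcal V}}{\partial x_j\partial x_\ell}$ for $j,\ell=1,\dots,d$; $[\nabla^2_{xy}\mathcal L^{\mathcal V}]_{j\ell}=-\mu\,\frac{\partial^2\sigma^{\mathcal V}}{\partial x_j\partial z_\ell}$ for $\ell=1,2$ and $[\nabla^2_{xy}\mathcal L^{\mathcal V}]_{j3}=-\frac{\partial\sigma^{\mathcal V}}{\partial x_j}$ for $j=1,\dots,d$; and $[\nabla^2_{yy}\mathcal L^{\mathcal V}]_{j\ell}=-\frac{\partial^2}{\partial y_j\partial y_\ell}\big[\mu\,\sigma^{\mathcal V}(\widetilde x,z)\big]$ at $y=y^{\mathcal V}(\widetilde x)$ for $j,\ell=1,2,3$. -/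

import Mathlib

open scoped Matrix

noncomputable section

namespace PSA

/-- The smallest singular value `σ_min(M)` of an `n × k` matrix with `k ≤ n` columns: the last one
of its `k` singular values, which `LinearMap.singularValues` lists in descending order from index
`0`. (For `k = 0` there is no singular value and the value is `0` by convention.) -/
def sigmaMin {n k : ℕ} (M : Matrix (Fin n) (Fin k) ℂ) : ℝ :=
  (Matrix.toEuclideanLin M).singularValues (k - 1)

/-- The smallest singular value of the `n × k` matrix `M` is simple: it occurs exactly once among
the `k` singular values of `M`, repeated according to multiplicity. -/
def SigmaMinSimple {n k : ℕ} (M : Matrix (Fin n) (Fin k) ℂ) : Prop :=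
  ∃! i : Fin k, (Matrix.toEuclideanLin M).singularValues i = sigmaMin M

/-- `u, v` is a consistent pair of unit left and unit right singular vectors of `M` for its smallest
singular value: `M v = σ_min(M) u`, `u^* M = σ_min(M) v^*`. -/
def IsConsistentPair {n k : ℕ} (M : Matrix (Fin n) (Fin k) ℂ) (u : Fin n → ℂ) (v : Fin k → ℂ) :
    Prop :=
  star u ⬝ᵥ u = 1 ∧ star v ⬝ᵥ v = 1 ∧
    M *ᵥ v = (sigmaMin M : ℂ) • u ∧ star u ᵥ* M = (sigmaMin M : ℂ) • star v

/-- The columns of `V` form an orthonormal basis of the subspace `𝒱` of `ℂ^n`. -/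
def IsBasisMatrix {n k : ℕ} (V : Matrix (Fin n) (Fin k) ℂ)
    (𝒱 : Submodule ℂ (EuclideanSpace ℂ (Fin n))) : Prop :=
  Orthonormal ℂ (fun j : Fin k => WithLp.toLp 2 (V.col j)) ∧
    Submodule.span ℂ (Set.range fun j : Fin k => WithLp.toLp 2 (V.col j)) = 𝒱

/-- Some matrix whose columns form an orthonormal basis of `𝒱`. -/
def basisMatrix {n : ℕ} (𝒱 : Submodule ℂ (EuclideanSpace ℂ (Fin n))) :
    Matrix (Fin n) (Fin (Module.finrank ℂ 𝒱)) ℂ :=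
  Matrix.of fun i j => (stdOrthonormalBasis ℂ 𝒱 j : EuclideanSpace ℂ (Fin n)) i

/-- `A(x) = f₁(x) A₁ + ⋯ + f_κ(x) A_κ`. -/
def matrixFunction {d n κ : ℕ} (f : Fin κ → EuclideanSpace ℝ (Fin d) → ℝ)
    (A : Fin κ → Matrix (Fin n) (Fin n) ℂ) (x : EuclideanSpace ℝ (Fin d)) :
    Matrix (Fin n) (Fin n) ℂ :=
  ∑ i, f i x • A i

section Reduced

variable {d n : ℕ} (A : EuclideanSpace ℝ (Fin d) → Matrix (Fin n) (Fin n) ℂ)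
  (𝒱 : Submodule ℂ (EuclideanSpace ℂ (Fin n))) (ε : ℝ)

/-- `A^V(x, z) = A(x) V - z V`. -/
def redMatrix {k : ℕ} (V : Matrix (Fin n) (Fin k) ℂ) (x : EuclideanSpace ℝ (Fin d)) (z : ℂ) :
    Matrix (Fin n) (Fin k) ℂ :=
  A x * V - z • V

/-- `σ^𝒱(x, z) = σ_min(A(x) V - z V)`, where the columns of `V` form an orthonormal basis of `𝒱`;
by `redSigma_eq` below, any such `V` may be taken. -/
def redSigma (x : EuclideanSpace ℝ (Fin d)) (z : ℂ) : ℝ :=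
  sigmaMin (redMatrix A (basisMatrix 𝒱) x z)

/-- The reduced pseudospectrum `Λ_ε^𝒱(x)`. -/
def redPseudospectrum (x : EuclideanSpace ℝ (Fin d)) : Set ℂ :=
  {z | redSigma A 𝒱 x z ≤ ε}

/-- The reduced pseudospectral abscissa `α_ε^𝒱(x)`. -/
def redAbscissa (x : EuclideanSpace ℝ (Fin d)) : ℝ :=
  sSup (Complex.re '' redPseudospectrum A 𝒱 ε x)

/-- `z` is an optimal point of `max {z₁ | σ^𝒱(x, z) - ε ≤ 0}`. -/
def IsOptimal (x : EuclideanSpace ℝ (Fin d)) (z : ℂ) : Prop :=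
  z ∈ redPseudospectrum A 𝒱 ε x ∧ ∀ w ∈ redPseudospectrum A 𝒱 ε x, w.re ≤ z.re

end Reduced

section PartialDerivatives

/-- The partial derivative `∂g/∂x_j` at `x`. -/
def pderiv {m : ℕ} (j : Fin m) (g : EuclideanSpace ℝ (Fin m) → ℝ) (x : EuclideanSpace ℝ (Fin m)) :
    ℝ :=
  lineDeriv ℝ g x (EuclideanSpace.single j 1)

/-- The second partial derivative `∂²g/∂x_j∂x_ℓ` at `x`. -/
def pderiv₂ {m : ℕ} (j l : Fin m) (g : EuclideanSpace ℝ (Fin m) → ℝ)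
    (x : EuclideanSpace ℝ (Fin m)) : ℝ :=
  pderiv l (pderiv j g) x

/-- The mixed second partial derivative `∂²g/∂x_j∂y_ℓ` at `(x, y)`. -/
def pderivMixed {m m' : ℕ} (j : Fin m) (l : Fin m')
    (g : EuclideanSpace ℝ (Fin m) → EuclideanSpace ℝ (Fin m') → ℝ)
    (x : EuclideanSpace ℝ (Fin m)) (y : EuclideanSpace ℝ (Fin m')) : ℝ :=
  pderiv l (fun y' => pderiv j (fun x' => g x' y') x) y

/-- The Hessian matrix of `g` at `x`. -/
def hessian {m : ℕ} (g : EuclideanSpace ℝ (Fin m) → ℝ) (x : EuclideanSpace ℝ (Fin m)) :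
    Matrix (Fin m) (Fin m) ℝ :=
  Matrix.of fun j l => pderiv₂ j l g x

/-- The block `∇²_{xy} g (x, y)`. -/
def hessianMixed {m m' : ℕ} (g : EuclideanSpace ℝ (Fin m) → EuclideanSpace ℝ (Fin m') → ℝ)
    (x : EuclideanSpace ℝ (Fin m)) (y : EuclideanSpace ℝ (Fin m')) : Matrix (Fin m) (Fin m') ℝ :=
  Matrix.of fun j l => pderivMixed j l g x y

/-- The entrywise partial derivative `∂M/∂x_j` of a complex matrix-valued function. -/
def pderivMatrix {d n k : ℕ} (j : Fin d)
    (M : EuclideanSpace ℝ (Fin d) → Matrix (Fin n) (Fin k) ℂ) (x : EuclideanSpace ℝ (Fin d)) :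
    Matrix (Fin n) (Fin k) ℂ :=
  Matrix.of fun a b => lineDeriv ℝ (fun x' => M x' a b) x (EuclideanSpace.single j 1)

end PartialDerivatives

section Lagrangian

variable {d n : ℕ} (A : EuclideanSpace ℝ (Fin d) → Matrix (Fin n) (Fin n) ℂ)
  (𝒱 : Submodule ℂ (EuclideanSpace ℂ (Fin n))) (ε : ℝ)

/-- `σ^𝒱(x, z)` as a function of `x ∈ ℝ^d` and `z = (z₁, z₂) ∈ ℝ²`. -/
def redSigmaReal (x : EuclideanSpace ℝ (Fin d)) (z : EuclideanSpace ℝ (Fin 2)) : ℝ :=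
  redSigma A 𝒱 x ⟨z 0, z 1⟩

/-- The Lagrangian `L^𝒱(x, y) = z₁ - μ (σ^𝒱(x, z) - ε)`, where `y = (z₁, z₂, μ)`. -/
def lagrangian (x : EuclideanSpace ℝ (Fin d)) (y : EuclideanSpace ℝ (Fin 3)) : ℝ :=
  y 0 - y 2 * (redSigma A 𝒱 x ⟨y 0, y 1⟩ - ε)

/-- The point `y = (z₁, z₂, μ)`. -/
def mkY (z : ℂ) (μ : ℝ) : EuclideanSpace ℝ (Fin 3) := !₂[z.re, z.im, μ]

/-- `μ` is a Lagrange multiplier of `max {z₁ | σ^𝒱(x, z) - ε ≤ 0}` at the point `z`: sign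
condition, stationarity of the Lagrangian in `z₁` and `z₂`, and complementarity. -/
def IsMultiplier (x : EuclideanSpace ℝ (Fin d)) (z : ℂ) (μ : ℝ) : Prop :=
  0 ≤ μ ∧ pderiv 0 (lagrangian A 𝒱 ε x) (mkY z μ) = 0 ∧
    pderiv 1 (lagrangian A 𝒱 ε x) (mkY z μ) = 0 ∧ μ * (redSigma A 𝒱 x z - ε) = 0

/-- `x` is a nondegenerate point of the restriction of `A(·)` to `𝒱`: the optimal `z` is unique, the
smallest singular value is simple there, and `∇²_{yy} L^𝒱` is nonsingular at `y = (z, μ)`, where `μ`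
is the Lagrange multiplier that corresponds to `z`. -/
def IsNondegenerate (x : EuclideanSpace ℝ (Fin d)) : Prop :=
  ∃ (z : ℂ) (μ : ℝ),
    IsOptimal A 𝒱 ε x z ∧ (∀ w, IsOptimal A 𝒱 ε x w → w = z) ∧
    (∀ (k : ℕ) (V : Matrix (Fin n) (Fin k) ℂ), IsBasisMatrix V 𝒱 →
      SigmaMinSimple (redMatrix A V x z)) ∧
    IsMultiplier A 𝒱 ε x z μ ∧
    IsUnit (hessian (lagrangian A 𝒱 ε x) (mkY z μ))

end Lagrangian

section WellDefined

theorem isBasisMatrix_basisMatrix {n : ℕ} (𝒱 : Submodule ℂ (EuclideanSpace ℂ (Fin n))) :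
    IsBasisMatrix (basisMatrix 𝒱) 𝒱 := by
  have h : (fun j => WithLp.toLp 2 ((basisMatrix 𝒱).col j))
      = fun j => (stdOrthonormalBasis ℂ 𝒱 j : EuclideanSpace ℂ (Fin n)) := by
    ext j i; rfl
  rw [IsBasisMatrix, h]
  refine ⟨(stdOrthonormalBasis ℂ 𝒱).orthonormal.comp_linearIsometry 𝒱.subtypeₗᵢ, ?_⟩
  have h2 := (stdOrthonormalBasis ℂ 𝒱).toBasis.span_eq
  have h3 := congrArg (Submodule.map 𝒱.subtype) h2
  rw [Submodule.map_span, Submodule.map_top, Submodule.range_subtype, ← Set.range_comp] at h3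
  simpa [Function.comp_def] using h3

/-- For `k > 0`, `σ_min(M)` is the minimum of `‖M v‖` over the unit vectors `v`. -/
theorem isLeast_sigmaMin {n k : ℕ} (hk : 0 < k) (M : Matrix (Fin n) (Fin k) ℂ) :
    IsLeast {s : ℝ | ∃ v, ‖v‖ = 1 ∧ ‖Matrix.toEuclideanLin M v‖ = s} (sigmaMin M) := by
  set T := Matrix.toEuclideanLin M with hT
  have hfr : Module.finrank ℂ (EuclideanSpace ℂ (Fin k)) = k := by simp
  have hS := T.isSymmetric_adjoint_comp_self
  let b := hS.eigenvectorBasis hfr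
  let i₀ : Fin k := ⟨k - 1, by omega⟩
  have hs : sigmaMin M ^ 2 = hS.eigenvalues hfr i₀ := T.sq_singularValues_of_lt hfr i₀.2
  have hs0 : 0 ≤ sigmaMin M := T.singularValues_nonneg _
  have hnorm : ∀ v, ‖T v‖ ^ 2 = ∑ i, hS.eigenvalues hfr i * ‖inner ℂ (b i) v‖ ^ 2 := by
    intro v
    have h1 : (‖T v‖ : ℂ) ^ 2 = inner ℂ v ((LinearMap.adjoint T ∘ₗ T) v) := by
      rw [LinearMap.comp_apply, LinearMap.adjoint_inner_right, inner_self_eq_norm_sq_to_K]; rfl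
    rw [← b.sum_inner_mul_inner] at h1
    have h2 : ∀ i, inner ℂ v (b i) * inner ℂ (b i) ((LinearMap.adjoint T ∘ₗ T) v)
        = ((hS.eigenvalues hfr i * ‖inner ℂ (b i) v‖ ^ 2 : ℝ) : ℂ) := by
      intro i
      rw [← hS (b i) v, hS.apply_eigenvectorBasis hfr i, inner_smul_left,
        ← inner_conj_symm v (b i)]
      have h3 := Complex.conj_mul' (inner ℂ (b i) v)
      have h4 : (starRingEnd ℂ) ((hS.eigenvalues hfr i : ℝ) : ℂ) = (hS.eigenvalues hfr i : ℂ) :=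
        Complex.conj_ofReal _
      push_cast
      rw [← h3]
      erw [h4]
      ring
    simp_rw [h2] at h1
    exact_mod_cast h1
  constructor
  · refine ⟨b i₀, b.orthonormal.1 i₀, ?_⟩
    have h := hnorm (b i₀)
    have h' : ∀ i, ‖inner ℂ (b i) (b i₀)‖ ^ 2 = if i = i₀ then (1 : ℝ) else 0 := by
      intro i
      rw [orthonormal_iff_ite.mp b.orthonormal i i₀]
      split_ifs <;> simp
    simp only [h', mul_ite, mul_one, mul_zero, Finset.sum_ite_eq', Finset.mem_univ, if_true] at h
    rw [← hs] at h
    exact (sq_eq_sq₀ (norm_nonneg _) hs0).mp h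
  · rintro s ⟨v, hv, rfl⟩
    refine le_of_sq_le_sq ?_ (norm_nonneg _)
    rw [hnorm v, hs]
    have h1 : ∑ i, ‖inner ℂ (b i) v‖ ^ 2 = 1 := by
      rw [b.sum_sq_norm_inner_right, hv]; norm_num
    calc hS.eigenvalues hfr i₀ = ∑ i, hS.eigenvalues hfr i₀ * ‖inner ℂ (b i) v‖ ^ 2 := by
          rw [← Finset.mul_sum, h1, mul_one]
      _ ≤ _ := by
          refine Finset.sum_le_sum fun i _ => mul_le_mul_of_nonneg_right ?_ (by positivity)
          exact hS.eigenvalues_antitone hfr (by simp only [i₀, Fin.le_def]; omega)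

theorem toEuclideanLin_eq_sum {n k : ℕ} (V : Matrix (Fin n) (Fin k) ℂ)
    (v : EuclideanSpace ℂ (Fin k)) :
    Matrix.toEuclideanLin V v = ∑ j, v j • WithLp.toLp 2 (V.col j) := by
  ext i
  simp [Matrix.toEuclideanLin, Matrix.mulVec, dotProduct, mul_comm]

theorem IsBasisMatrix.norm_toEuclideanLin {n k : ℕ} {V : Matrix (Fin n) (Fin k) ℂ}
    {𝒱 : Submodule ℂ (EuclideanSpace ℂ (Fin n))} (hV : IsBasisMatrix V 𝒱)
    (v : EuclideanSpace ℂ (Fin k)) : ‖Matrix.toEuclideanLin V v‖ = ‖v‖ := by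
  have h : (‖Matrix.toEuclideanLin V v‖ : ℂ) ^ 2 = (‖v‖ : ℂ) ^ 2 := by
    have h1 := inner_self_eq_norm_sq_to_K (𝕜 := ℂ) (Matrix.toEuclideanLin V v)
    have h2 := inner_self_eq_norm_sq_to_K (𝕜 := ℂ) v
    refine h1.symm.trans (Eq.trans ?_ h2)
    rw [toEuclideanLin_eq_sum, hV.1.inner_sum, PiLp.inner_apply]
    simp [Complex.conj_mul']
  have h' : ‖Matrix.toEuclideanLin V v‖ ^ 2 = ‖v‖ ^ 2 := by exact_mod_cast h
  exact (sq_eq_sq₀ (norm_nonneg _) (norm_nonneg _)).mp h'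

theorem IsBasisMatrix.range_eq {n k : ℕ} {V : Matrix (Fin n) (Fin k) ℂ}
    {𝒱 : Submodule ℂ (EuclideanSpace ℂ (Fin n))} (hV : IsBasisMatrix V 𝒱)
    (w : EuclideanSpace ℂ (Fin n)) : w ∈ 𝒱 ↔ ∃ v, Matrix.toEuclideanLin V v = w := by
  rw [← hV.2, Submodule.mem_span_range_iff_exists_fun]
  constructor
  · rintro ⟨c, rfl⟩
    exact ⟨WithLp.toLp 2 c, toEuclideanLin_eq_sum V _⟩
  · rintro ⟨v, rfl⟩
    exact ⟨v, (toEuclideanLin_eq_sum V v).symm⟩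

/-- `σ^𝒱(x, z)` does not depend on the orthonormal basis of `𝒱`. -/
theorem redSigma_eq {d n k : ℕ} (A : EuclideanSpace ℝ (Fin d) → Matrix (Fin n) (Fin n) ℂ)
    (𝒱 : Submodule ℂ (EuclideanSpace ℂ (Fin n))) {V : Matrix (Fin n) (Fin k) ℂ}
    (hV : IsBasisMatrix V 𝒱) (x : EuclideanSpace ℝ (Fin d)) (z : ℂ) :
    redSigma A 𝒱 x z = sigmaMin (redMatrix A V x z) := by
  have hB := isBasisMatrix_basisMatrix 𝒱
  have hk : Module.finrank ℂ 𝒱 = k := by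
    rw [← hV.2, finrank_span_eq_card hV.1.linearIndependent, Fintype.card_fin]
  rcases Nat.eq_zero_or_pos k with h0 | hpos
  · have hz : ∀ {m : ℕ} (M : Matrix (Fin n) (Fin m) ℂ), m = 0 → sigmaMin M = 0 := by
      intro m M hm
      exact LinearMap.singularValues_of_finrank_le _ (by simp [hm])
    rw [redSigma, hz _ (hk.trans h0), hz _ h0]
  · have key : ∀ {m : ℕ} (W : Matrix (Fin n) (Fin m) ℂ), IsBasisMatrix W 𝒱 →
        {s : ℝ | ∃ v, ‖v‖ = 1 ∧ ‖Matrix.toEuclideanLin (redMatrix A W x z) v‖ = s}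
        = {s : ℝ | ∃ w ∈ 𝒱, ‖w‖ = 1 ∧ ‖Matrix.toEuclideanLin (A x) w - z • w‖ = s} := by
      intro m W hW
      have hM : ∀ v, Matrix.toEuclideanLin (redMatrix A W x z) v =
          Matrix.toEuclideanLin (A x) (Matrix.toEuclideanLin W v)
            - z • Matrix.toEuclideanLin W v := by
        intro v
        ext i
        simp [redMatrix, Matrix.toEuclideanLin]
      ext s
      constructor
      · rintro ⟨v, hv, rfl⟩
        exact ⟨_, (hW.range_eq _).mpr ⟨v, rfl⟩, by rw [hW.norm_toEuclideanLin, hv], by rw [hM]⟩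
      · rintro ⟨w, hw, hw1, rfl⟩
        obtain ⟨v, rfl⟩ := (hW.range_eq w).mp hw
        exact ⟨v, by rw [← hW.norm_toEuclideanLin, hw1], by rw [hM]⟩
    have h1 := isLeast_sigmaMin (hk ▸ hpos) (redMatrix A (basisMatrix 𝒱) x z)
    have h2 := isLeast_sigmaMin hpos (redMatrix A V x z)
    rw [key _ hB] at h1
    rw [key _ hV] at h2
    exact h1.unique h2

end WellDefined

end PSA

end

section

open scoped Topology ContDiff
open Filter

namespace PSA

/-! The abscissa is the value function of a parametric optimization problem. Its derivatives come
from the envelope theorem once the primal-dual solution is known to be analytic in `x`.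

Three facts give that analyticity. First, the multiplier cannot vanish, so the constraint is active
and `σ = ε > 0` at the optimal point. Since `σ` is also simple there, its square is a simple root of
an analytic family of polynomials, and `σ` is jointly analytic in `(x, z)` (`analyticAt_sigmaMin`).
Second, uniqueness of the optimal point and local uniform boundedness of the pseudospectra give, by
compactness, maximizers for all nearby `x`, converging to that point (`exists_maximizer_near`).
Third, these maximizers paired with `μ = 1/σ_{z₁}` form a continuous branch `φ` of critical points
of the Lagrangian; the nonsingular block `∇²_{yy} L` makes the branch analytic by the implicit
function theorem (`exists_analyticAt_primalDual`).

Along the branch the constraint stays active, so `α(x) = L(x, φ(x))`. In the first derivative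
criticality removes `φ'`, leaving `-μ ∂σ/∂x_j`. Differentiating once more, and differentiating the
critical point equation to solve for `φ'`, yields the Schur complement (`hessian_value_eq`). The
singular vector formulas follow from `hasDerivAt_sigmaMin_eq`. -/

theorem isInvertible_of_injective {E F : Type*} [NormedAddCommGroup E] [NormedSpace ℝ E]
    [FiniteDimensional ℝ E] [NormedAddCommGroup F] [NormedSpace ℝ F] [FiniteDimensional ℝ F]
    (h : Module.finrank ℝ E = Module.finrank ℝ F) (T : E →L[ℝ] F) (hT : Function.Injective T) :
    T.IsInvertible :=
  ⟨(LinearEquiv.ofInjectiveOfFinrankEq (T : E →ₗ[ℝ] F) hT h).toContinuousLinearEquiv, by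
    ext v; rfl⟩

/-- An implicitly defined function is analytic; `φ` is any function which solves the equation and is
continuous at the base point. -/
theorem analyticAt_of_implicit {E F G : Type*} [NormedAddCommGroup E] [NormedSpace ℝ E]
    [CompleteSpace E] [NormedAddCommGroup F] [NormedSpace ℝ F] [FiniteDimensional ℝ F]
    [NormedAddCommGroup G] [NormedSpace ℝ G] [FiniteDimensional ℝ G]
    (h : Module.finrank ℝ F = Module.finrank ℝ G) {g : E × F → G} {x : E} {φ : E → F}
    (hg : AnalyticAt ℝ g (x, φ x))
    (hinj : ∀ v : F, fderiv ℝ g (x, φ x) (0, v) = 0 → v = 0) (hφ : ContinuousAt φ x)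
    (hzero : ∀ᶠ x' in 𝓝 x, g (x', φ x') = 0) : AnalyticAt ℝ φ x := by
  have : CompleteSpace F := FiniteDimensional.complete ℝ F
  have : CompleteSpace G := FiniteDimensional.complete ℝ G
  have hinv : (fderiv ℝ g (x, φ x) ∘L .inr ℝ E F).IsInvertible := by
    refine isInvertible_of_injective h _ ((injective_iff_map_eq_zero _).2 fun v hv => hinj v ?_)
    simpa using hv
  have hc : ContDiffAt ℝ ω g (x, φ x) := hg.contDiffAt
  have h1 := hc.eventually_apply_eq_iff_implicitFunction (by simp) hinv
  have h2 := (hc.contDiffAt_implicitFunction (by simp) hinv).analyticAt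
  refine h2.congr ?_
  -- Continuity keeps `(x', φ x')` in the neighbourhood where the solution is unique, so `φ` agrees
  -- there with the implicit function.
  have h3 : ContinuousAt (fun x' => (x', φ x')) x := continuousAt_id.prodMk hφ
  filter_upwards [h3.eventually h1, hzero] with x' h4 h5
  exact h4.1 (by rw [h5, hzero.self_of_nhds])

/-! ### Analyticity and derivative of the smallest singular value -/

section SingularValues

variable {n k : ℕ}

/-- Exhibits the squared singular values as the roots of a polynomial whose coefficients are
polynomial in the entries of `M` and their conjugates, to which the implicit function theorem
applies. -/
theorem det_sub_conjTranspose_mul_self (M : Matrix (Fin n) (Fin k) ℂ) (t : ℝ) :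
    ((t : ℂ) • (1 : Matrix (Fin k) (Fin k) ℂ) - Mᴴ * M).det
      = ((∏ i : Fin k, (t - (Matrix.toEuclideanLin M).singularValues i ^ 2) : ℝ) : ℂ) := by
  set T := Matrix.toEuclideanLin M with hT
  have hfr : Module.finrank ℂ (EuclideanSpace ℂ (Fin k)) = k := by simp
  have h1 : LinearMap.adjoint T ∘ₗ T = Matrix.toEuclideanLin (Mᴴ * M) := by
    rw [hT, ← Matrix.toEuclideanLin_conjTranspose_eq_adjoint]
    exact (Matrix.toLpLin_mul_same 2 _ _).symm
  have h2 : (LinearMap.adjoint T ∘ₗ T).charpoly = (Mᴴ * M).charpoly := by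
    rw [h1]
    unfold Matrix.toEuclideanLin
    rw [Matrix.toLpLin_eq_toLin, Matrix.charpoly_toLin]
  have h3 := Matrix.eval_charpoly (Mᴴ * M) (t : ℂ)
  rw [← h2, T.isSymmetric_adjoint_comp_self.charpoly_eq hfr, Polynomial.eval_prod] at h3
  simp only [← T.sq_singularValues_fin hfr] at h3
  have h4 : (t : ℂ) • (1 : Matrix (Fin k) (Fin k) ℂ) = Matrix.scalar (Fin k) (t : ℂ) := by
    rw [Matrix.smul_one_eq_diagonal]; rfl
  rw [h4, ← h3]
  push_cast
  simp

theorem sigmaMin_nonneg (M : Matrix (Fin n) (Fin k) ℂ) : 0 ≤ sigmaMin M :=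
  LinearMap.singularValues_nonneg _ _

theorem sigmaMin_le_norm (hk : 0 < k) (M : Matrix (Fin n) (Fin k) ℂ)
    (v : EuclideanSpace ℂ (Fin k)) (hv : ‖v‖ = 1) : sigmaMin M ≤ ‖Matrix.toEuclideanLin M v‖ :=
  (isLeast_sigmaMin hk M).2 ⟨v, hv, rfl⟩

/-- The smallest singular value is 1-Lipschitz in the operator norm: test one matrix on the
minimizing unit vector of the other. No simplicity is involved. -/
theorem continuous_sigmaMin : Continuous (sigmaMin : Matrix (Fin n) (Fin k) ℂ → ℝ) := by
  rcases Nat.eq_zero_or_pos k with h0 | hk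
  · have : (sigmaMin : Matrix (Fin n) (Fin k) ℂ → ℝ) = fun _ => 0 := by
      funext M
      exact LinearMap.singularValues_of_finrank_le _ (by simp [h0])
    rw [this]; exact continuous_const
  let Φ : Matrix (Fin n) (Fin k) ℂ →ₗ[ℂ] (EuclideanSpace ℂ (Fin k) →L[ℂ] EuclideanSpace ℂ (Fin n)) :=
    (Matrix.toEuclideanLin.trans LinearMap.toContinuousLinearMap).toLinearMap
  have hΦ : Continuous Φ := Φ.continuous_of_finiteDimensional
  have key : ∀ M N, sigmaMin M ≤ sigmaMin N + ‖Φ (M - N)‖ := by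
    intro M N
    obtain ⟨v, hv, hv'⟩ := (isLeast_sigmaMin hk N).1
    have h1 : Matrix.toEuclideanLin M v = Matrix.toEuclideanLin N v + Φ (M - N) v := by
      simp [Φ]
    calc sigmaMin M ≤ ‖Matrix.toEuclideanLin M v‖ := sigmaMin_le_norm hk M v hv
      _ ≤ ‖Matrix.toEuclideanLin N v‖ + ‖Φ (M - N) v‖ := by rw [h1]; exact norm_add_le _ _
      _ ≤ sigmaMin N + ‖Φ (M - N)‖ := by
          rw [hv']
          have := (Φ (M - N)).le_opNorm v
          rw [hv, mul_one] at this
          linarith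
  rw [continuous_iff_continuousAt]
  intro M
  rw [ContinuousAt, tendsto_iff_dist_tendsto_zero]
  have hlim : Tendsto (fun N => ‖Φ (N - M)‖) (𝓝 M) (𝓝 0) := by
    have : Continuous fun N => ‖Φ (N - M)‖ := (hΦ.comp (continuous_id.sub continuous_const)).norm
    simpa using this.tendsto M
  refine squeeze_zero (fun _ => dist_nonneg) (fun N => ?_) hlim
  have h1 := key N M
  have h2 := key M N
  rw [← neg_sub, map_neg, norm_neg] at h2
  rw [Real.dist_eq, abs_le]
  constructor <;> linarith

variable {E : Type*} [NormedAddCommGroup E] [NormedSpace ℝ E]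

theorem analyticAt_det {m : ℕ} {N : E → Matrix (Fin m) (Fin m) ℂ} {e : E}
    (hN : ∀ i j, AnalyticAt ℝ (fun e => N e i j) e) : AnalyticAt ℝ (fun e => (N e).det) e := by
  simp only [Matrix.det_apply]
  refine Finset.analyticAt_fun_sum _ fun σ _ => ?_
  have h : AnalyticAt ℝ (fun e => ∏ i, N e (σ i) i) e :=
    Finset.analyticAt_fun_prod _ fun i _ => hN _ _
  have h2 : ∀ e, Equiv.Perm.sign σ • ∏ i, N e (σ i) i
      = ((Equiv.Perm.sign σ : ℤ) : ℂ) * ∏ i, N e (σ i) i := fun e => by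
    simp [Units.smul_def]
  simp only [h2]
  exact analyticAt_const.mul h

theorem SigmaMinSimple.pos {M : Matrix (Fin n) (Fin k) ℂ} (h : SigmaMinSimple M) : 0 < k := by
  obtain ⟨i, -⟩ := h
  exact i.pos

/-- A simple root of an analytic family of polynomials is analytic; this is applied to the square of
the singular value, and positivity then permits the square root. -/
theorem analyticAt_sigmaMin [CompleteSpace E] {M : E → Matrix (Fin n) (Fin k) ℂ} {e : E}
    (hM : ∀ i j, AnalyticAt ℝ (fun e => M e i j) e) (hs : SigmaMinSimple (M e))
    (hpos : 0 < sigmaMin (M e)) : AnalyticAt ℝ (fun e => sigmaMin (M e)) e := by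
  have hk := hs.pos
  let i₀ : Fin k := ⟨k - 1, by omega⟩
  -- The determinant is real by `det_sub_conjTranspose_mul_self`; taking the real part makes the
  -- equation scalar, in one real unknown.
  let g : E × ℝ → ℝ := fun p => ((p.2 : ℂ) • (1 : Matrix (Fin k) (Fin k) ℂ) - (M p.1)ᴴ * M p.1).det.re
  have hg : ∀ p, g p = ∏ i : Fin k, (p.2 - (Matrix.toEuclideanLin (M p.1)).singularValues i ^ 2) := by
    intro p
    simp only [g, det_sub_conjTranspose_mul_self, Complex.ofReal_re]
  have hMc : ∀ i j, ContinuousAt (fun e => M e i j) e := fun i j => (hM i j).continuousAt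
  have hcont : ContinuousAt (fun e => sigmaMin (M e)) e :=
    continuous_sigmaMin.continuousAt.comp
      (continuousAt_pi.2 fun i => continuousAt_pi.2 fun j => hMc i j)
  have hzero : ∀ e', g (e', sigmaMin (M e') ^ 2) = 0 := fun e' => by
    rw [hg]
    exact Finset.prod_eq_zero (Finset.mem_univ i₀) (by simp [sigmaMin, i₀])
  have hga : AnalyticAt ℝ g (e, sigmaMin (M e) ^ 2) := by
    refine (Complex.reCLM.analyticAt _).comp (analyticAt_det fun i j => ?_)
    have hfst : ∀ i j, AnalyticAt ℝ (fun p : E × ℝ => M p.1 i j) (e, sigmaMin (M e) ^ 2) :=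
      fun i j => AnalyticAt.fun_comp (g := fun e => M e i j) (f := fun p : E × ℝ => p.1) (hM i j) analyticAt_fst
    -- Conjugation is analytic over `ℝ` but not over `ℂ`.
    have hconj : ∀ i j, AnalyticAt ℝ (fun p : E × ℝ => star (M p.1 i j)) (e, sigmaMin (M e) ^ 2) :=
      fun i j => (Complex.conjCLE.analyticAt _).comp (hfst i j)
    simp only [Matrix.sub_apply, Matrix.smul_apply, Matrix.mul_apply, Matrix.conjTranspose_apply,
      smul_eq_mul]
    refine AnalyticAt.sub (AnalyticAt.mul ?_ analyticAt_const)
      (Finset.analyticAt_fun_sum _ fun l _ => (hconj _ _).mul (hfst _ _))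
    exact (Complex.ofRealCLM.analyticAt _).comp analyticAt_snd
  have hinj : ∀ v : ℝ, fderiv ℝ g (e, sigmaMin (M e) ^ 2) (0, v) = 0 → v = 0 := by
    intro v hv
    set c := sigmaMin (M e) ^ 2 with hc
    -- The product over the other singular values: the `t`-derivative of `g` at the root is `q c`,
    -- nonzero because the root is simple.
    let q : ℝ → ℝ := fun t =>
      ∏ i ∈ Finset.univ.erase i₀, (t - (Matrix.toEuclideanLin (M e)).singularValues i ^ 2)
    have hgq : ∀ t, g (e, t) = (t - c) * q t := fun t => by
      rw [hg, ← Finset.mul_prod_erase _ _ (Finset.mem_univ i₀)]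
      rfl
    have hq : q c ≠ 0 := by
      refine Finset.prod_ne_zero_iff.2 fun i hi h0 => Finset.ne_of_mem_erase hi ?_
      refine hs.unique ?_ rfl
      have : (Matrix.toEuclideanLin (M e)).singularValues i ^ 2 = sigmaMin (M e) ^ 2 := by linarith
      exact (sq_eq_sq₀ (LinearMap.singularValues_nonneg _ _) (sigmaMin_nonneg _)).1 this
    have hqd : DifferentiableAt ℝ q c := by
      simp only [q]; fun_prop
    have h1 : HasDerivAt (fun t => (t - c) * q t) (q c) c := by
      have := ((hasDerivAt_id c).sub_const c).mul hqd.hasDerivAt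
      simp only [id, sub_self, zero_mul, add_zero, one_mul] at this
      exact this
    have h2 : HasDerivAt (fun t => g (e, t)) (fderiv ℝ g (e, c) (0, 1)) c := by
      have h3 : HasDerivAt (fun t : ℝ => (e, t)) ((0 : E), (1 : ℝ)) c :=
        (hasDerivAt_const c e).prodMk (hasDerivAt_id c)
      exact hga.differentiableAt.hasFDerivAt.comp_hasDerivAt c h3
    have h4 : fderiv ℝ g (e, c) (0, 1) = q c := by
      refine h2.unique ?_
      simpa only [hgq] using h1
    have h5 : ((0 : E), v) = v • ((0 : E), (1 : ℝ)) := by simp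
    rw [h5, map_smul, h4, smul_eq_mul] at hv
    exact (mul_eq_zero.1 hv).resolve_right hq
  have hsq : AnalyticAt ℝ (fun e => sigmaMin (M e) ^ 2) e :=
    analyticAt_of_implicit rfl hga hinj (hcont.pow 2) (Eventually.of_forall hzero)
  have hsqrt : AnalyticAt ℝ (fun t : ℝ => √t) (sigmaMin (M e) ^ 2) :=
    (Real.contDiffAt_sqrt (n := ω) (by positivity)).analyticAt
  have := AnalyticAt.fun_comp (f := fun e => sigmaMin (M e) ^ 2) hsqrt hsq
  simpa only [Real.sqrt_sq (sigmaMin_nonneg _)] using this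

theorem sum_norm_sq_eq_one {m : ℕ} {w : Fin m → ℂ} (hw : star w ⬝ᵥ w = 1) :
    ∑ i, ‖w i‖ ^ 2 = 1 := by
  have h : ((∑ i, ‖w i‖ ^ 2 : ℝ) : ℂ) = 1 := by
    rw [← hw]
    simp [dotProduct, Complex.conj_mul']
  exact_mod_cast h

/-- With `v` frozen, `‖M(t') v‖² - σ_min(M(t'))²` is nonnegative and vanishes at `t' = t`, so its
derivative there is zero. Singular vectors need not be differentiated. -/
theorem hasDerivAt_sigmaMin_eq {M : ℝ → Matrix (Fin n) (Fin k) ℂ} {M' : Matrix (Fin n) (Fin k) ℂ}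
    {t s' : ℝ} (hM : ∀ i j, HasDerivAt (fun t => M t i j) (M' i j) t) (hk : 0 < k)
    (hpos : 0 < sigmaMin (M t)) (hs : HasDerivAt (fun t => sigmaMin (M t)) s' t)
    {u : Fin n → ℂ} {v : Fin k → ℂ} (huv : IsConsistentPair (M t) u v) :
    s' = (star u ⬝ᵥ M' *ᵥ v).re := by
  obtain ⟨hu, hv, hMv, -⟩ := huv
  have hv1 : ‖WithLp.toLp 2 v‖ = 1 := by
    have h' : ‖WithLp.toLp 2 v‖ ^ 2 = 1 := by
      rw [EuclideanSpace.norm_sq_eq]; exact sum_norm_sq_eq_one hv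
    exact (sq_eq_sq₀ (norm_nonneg _) zero_le_one).1 (by rw [h', one_pow])
  have hw : ∀ i, HasDerivAt (fun t => (M t *ᵥ v) i) ((M' *ᵥ v) i) t := fun i => by
    simp only [Matrix.mulVec, dotProduct]
    exact HasDerivAt.fun_sum fun j _ => (hM i j).mul_const (v j)
  have hN : HasDerivAt (fun t => ∑ i, ‖(M t *ᵥ v) i‖ ^ 2)
      (∑ i, 2 * inner ℝ ((M t *ᵥ v) i) ((M' *ᵥ v) i)) t :=
    HasDerivAt.fun_sum fun i _ => (hw i).norm_sq
  have hval : ∀ t, ‖Matrix.toEuclideanLin (M t) (WithLp.toLp 2 v)‖ ^ 2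
      = ∑ i, ‖(M t *ᵥ v) i‖ ^ 2 := fun t => by
    rw [EuclideanSpace.norm_sq_eq]; rfl
  have hsum : ∑ i, 2 * inner ℝ ((M t *ᵥ v) i) ((M' *ᵥ v) i)
      = 2 * sigmaMin (M t) * (star u ⬝ᵥ M' *ᵥ v).re := by
    rw [dotProduct, Complex.re_sum, Finset.mul_sum]
    refine Finset.sum_congr rfl fun i _ => ?_
    rw [hMv, Complex.inner]
    simp [mul_assoc]
    ring
  have hN0 : ∑ i, ‖(M t *ᵥ v) i‖ ^ 2 = sigmaMin (M t) ^ 2 := by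
    rw [hMv]
    simp [mul_pow, ← Finset.mul_sum, sum_norm_sq_eq_one hu]
  have hmin : IsLocalMin (fun t => ∑ i, ‖(M t *ᵥ v) i‖ ^ 2 - sigmaMin (M t) ^ 2) t := by
    refine Eventually.of_forall fun t' => ?_
    have h1 := sigmaMin_le_norm hk (M t') _ hv1
    have h2 := pow_le_pow_left₀ (sigmaMin_nonneg _) h1 2
    rw [hval] at h2
    simp only [hN0, sub_self]
    linarith
  have h0 := hmin.hasDerivAt_eq_zero (hN.sub (hs.pow 2))
  rw [hsum] at h0
  have h1 : 2 * sigmaMin (M t) * ((star u ⬝ᵥ M' *ᵥ v).re - s') = 0 := by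
    rw [← h0]; push_cast; ring
  have := (mul_eq_zero.1 h1).resolve_left (by positivity)
  linarith

end SingularValues

/-! ### Stability of maximizers and first order conditions -/

section Optimal

/-- Maximizers depend semicontinuously on a parameter: if the maximizer `z₀` of `Re` on the sublevel
set `{s x₀ ≤ ε}` is unique, then maximizers exist near `x₀` and all of them are close to `z₀`. -/
theorem exists_maximizer_near {X : Type*} [TopologicalSpace X] {s : X → ℂ → ℝ} {x₀ : X} {z₀ : ℂ}
    {ε R : ℝ} (hcont : ∀ᶠ x in 𝓝 x₀, ∀ z, ContinuousAt (Function.uncurry s) (x, z))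
    (hcoer : ∀ᶠ x in 𝓝 x₀, ∀ z, s x z ≤ ε → ‖z‖ ≤ R)
    (hopt : ∀ w, s x₀ w ≤ ε → w.re ≤ z₀.re)
    (huniq : ∀ w, s x₀ w ≤ ε → w.re = z₀.re → w = z₀)
    (hdec : ∀ᶠ t : ℝ in 𝓝[>] 0, s x₀ (z₀ - t) < ε) :
    (∀ᶠ x in 𝓝 x₀, ∃ z, s x z ≤ ε ∧ ∀ w, s x w ≤ ε → w.re ≤ z.re) ∧
    ∀ N ∈ 𝓝 z₀, ∀ᶠ x in 𝓝 x₀, ∀ z, (s x z ≤ ε ∧ ∀ w, s x w ≤ ε → w.re ≤ z.re) → z ∈ N := by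
  have hlt : ∀ z, s x₀ z < ε → ∀ᶠ x in 𝓝 x₀, s x z < ε := by
    intro z hz
    have h1 : ContinuousAt (fun x => s x z) x₀ :=
      ContinuousAt.comp (g := Function.uncurry s) (f := fun x => (x, z))
        (hcont.self_of_nhds z) (by fun_prop)
    exact h1.eventually_lt_const hz
  constructor
  -- A strictly feasible point stays feasible for nearby `x`, so the compact sublevel set is
  -- nonempty.
  · obtain ⟨t, ht⟩ := hdec.exists
    filter_upwards [hlt _ ht, hcont, hcoer] with x h1 h2 h3
    have hc : Continuous (s x) := continuous_iff_continuousAt.2 fun z =>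
      ContinuousAt.comp (g := Function.uncurry s) (f := fun z => (x, z)) (h2 z) (by fun_prop)
    have hcl : IsClosed {z | s x z ≤ ε} := isClosed_le hc continuous_const
    have hK : IsCompact {z | s x z ≤ ε} :=
      (isCompact_closedBall (0 : ℂ) R).of_isClosed_subset hcl fun z hz => by
        simpa using h3 z hz
    obtain ⟨z, hz, hmax⟩ := hK.exists_isMaxOn ⟨_, h1.le⟩ Complex.continuous_re.continuousOn
    exact ⟨z, hz, fun w hw => hmax hw⟩
  · intro N hN
    obtain ⟨N', hN', hNo, hzN⟩ := mem_nhds_iff.1 hN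
    have hK : IsCompact (Metric.closedBall (0 : ℂ) R \ N') :=
      (isCompact_closedBall (0 : ℂ) R).diff hNo
    -- Away from `z₀`, a point is either infeasible or has smaller real part. Both are open
    -- conditions, so compactness makes the alternative uniform in the parameter and in the
    -- threshold for `Re`.
    have key : ∀ᶠ p : X × ℝ in 𝓝 (x₀, z₀.re), ∀ w ∈ Metric.closedBall (0 : ℂ) R \ N',
        ε < s p.1 w ∨ w.re < p.2 := by
      refine hK.eventually_forall_of_forall_eventually fun w hw => ?_
      by_cases h : s x₀ w ≤ ε
      · have h1 : w.re < z₀.re := lt_of_le_of_ne (hopt w h) fun h2 => hw.2 (huniq w h h2 ▸ hzN)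
        have h2 : ContinuousAt (fun q : (X × ℝ) × ℂ => q.2.re) ((x₀, z₀.re), w) := by fun_prop
        have h3 : ContinuousAt (fun q : (X × ℝ) × ℂ => q.1.2) ((x₀, z₀.re), w) := by fun_prop
        filter_upwards [h2.eventually_lt h3 h1] with q hq using Or.inr hq
      · have h1 : ContinuousAt (fun q : (X × ℝ) × ℂ => s q.1.1 q.2) ((x₀, z₀.re), w) :=
          ContinuousAt.comp (g := Function.uncurry s)
            (f := fun q : (X × ℝ) × ℂ => (q.1.1, q.2)) (hcont.self_of_nhds w) (by fun_prop)
        filter_upwards [h1.eventually_const_lt (not_le.1 h)] with q hq using Or.inl hq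
    rw [nhds_prod_eq] at key
    have hT : Tendsto (fun t : ℝ => z₀.re - t) (𝓝[>] 0) (𝓝 z₀.re) := by
      have : Continuous fun t : ℝ => z₀.re - t := by fun_prop
      simpa using (this.tendsto 0).mono_left nhdsWithin_le_nhds
    -- The threshold is lowered to `Re z₀ - t`, which the strictly feasible point `z₀ - t` attains
    -- for all nearby `x`; a maximizer outside `N'` would fall below it.
    have key_left : ∀ᶠ t : ℝ in 𝓝[>] 0, ∀ᶠ x in 𝓝 x₀, ∀ w ∈ Metric.closedBall (0 : ℂ) R \ N',
        ε < s x w ∨ w.re < z₀.re - t := by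
      have := (eventually_swap_iff.1 key).curry
      exact hT.eventually this
    obtain ⟨t, ht1, ht2⟩ := (key_left.and hdec).exists
    filter_upwards [ht1, hlt _ ht2, hcoer] with x h1 h2 h3 z hz
    by_contra hzn
    rcases h1 z ⟨by simpa using h3 z hz.1, fun h => hzn (hN' h)⟩ with h | h
    · exact absurd hz.1 (not_le.2 h)
    · have := hz.2 _ h2.le
      simp at this
      linarith

/-- A differentiable function decreases along a direction of negative slope. -/
theorem eventually_lt_of_hasFDerivAt_neg {E : Type*} [NormedAddCommGroup E] [NormedSpace ℝ E]
    {s : E → ℝ} {D : E →L[ℝ] ℝ} {z h : E} (hs : HasFDerivAt s D z) (hD : D h < 0) :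
    ∀ᶠ t : ℝ in 𝓝[>] 0, s (z + t • h) < s z := by
  have h1 : HasDerivAt (fun t : ℝ => s (z + t • h)) (D h) 0 := hs.hasLineDerivAt h
  have h2 := h1.tendsto_slope_zero_right
  filter_upwards [h2.eventually_lt_const hD, self_mem_nhdsWithin] with t ht ht0
  have ht0' : (0 : ℝ) < t := ht0
  simp only [zero_add, zero_smul, add_zero, smul_eq_mul] at ht
  have h3 : 0 < t⁻¹ := inv_pos.2 ht0'
  nlinarith

/-- First order conditions at a maximizer of `Re` on a sublevel set. -/
theorem eq_and_deriv_I_eq_zero_of_maximizer {s : ℂ → ℝ} {D : ℂ →L[ℝ] ℝ} {z : ℂ} {ε : ℝ}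
    (hs : HasFDerivAt s D z) (hz : s z ≤ ε)
    (hmax : ∀ w, s w ≤ ε → w.re ≤ z.re) : s z = ε ∧ D Complex.I = 0 := by
  constructor
  · by_contra hne
    have hlt : s z < ε := lt_of_le_of_ne hz hne
    have hc : ContinuousAt (fun t : ℝ => s (z + t)) 0 :=
      ContinuousAt.comp (g := s) (f := fun t : ℝ => z + t) (by simpa using hs.continuousAt)
        (by fun_prop)
    have h1 : ∀ᶠ t : ℝ in 𝓝[>] 0, s (z + t) < ε :=
      nhdsWithin_le_nhds (hc.eventually_lt_const (by simpa using hlt))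
    obtain ⟨t, ht, ht0⟩ := (h1.and self_mem_nhdsWithin).exists
    have ht0' : (0 : ℝ) < t := ht0
    have := hmax _ ht.le
    simp at this
    linarith
  · by_contra hne
    -- Chosen so that `D h = -1` while `Re h = 1`: moving along `h` stays feasible and increases the
    -- real part.
    let h : ℂ := 1 - ((D 1 + 1) / D Complex.I) • Complex.I
    have hDh : D h < 0 := by
      simp only [h, map_sub, map_smul, smul_eq_mul]
      rw [div_mul_cancel₀ _ hne]
      linarith
    obtain ⟨t, ht, ht0⟩ :=
      ((eventually_lt_of_hasFDerivAt_neg hs hDh).and self_mem_nhdsWithin).exists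
    have ht0' : (0 : ℝ) < t := ht0
    have := hmax _ (ht.le.trans hz)
    simp [h] at this
    linarith

end Optimal

/-! ### Analytic critical points and the envelope theorem -/

section Envelope

variable {X Y : Type*} [NormedAddCommGroup X] [NormedSpace ℝ X]
  [NormedAddCommGroup Y] [NormedSpace ℝ Y] [FiniteDimensional ℝ Y]

/-- A continuous family of nondegenerate critical points of `F (x, ·)` is analytic. -/
theorem analyticAt_criticalPoint [CompleteSpace X] {F : X × Y → ℝ} {x : X} {φ : X → Y}
    (hF : AnalyticAt ℝ F (x, φ x)) (hφ : ContinuousAt φ x)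
    (hcrit : ∀ᶠ x' in 𝓝 x, ∀ h, fderiv ℝ F (x', φ x') (0, h) = 0)
    (hnd : ∀ v, (∀ h, fderiv ℝ (fderiv ℝ F) (x, φ x) (0, v) (0, h) = 0) → v = 0) :
    AnalyticAt ℝ φ x := by
  -- `C` restricts a functional on `X × Y` to `Y`, so `C (fderiv ℝ F p)` is the partial derivative
  -- in `y`, with values in the dual of `Y`.
  let C := (ContinuousLinearMap.compL ℝ Y (X × Y) ℝ).flip (ContinuousLinearMap.inr ℝ X Y)
  have hC : ∀ T h, C T h = T (0, h) := fun T h => by simp [C]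
  have hg : AnalyticAt ℝ (fun p => C (fderiv ℝ F p)) (x, φ x) :=
    (C.analyticAt _).comp hF.fderiv
  have hd : fderiv ℝ (fun p => C (fderiv ℝ F p)) (x, φ x)
      = C ∘L fderiv ℝ (fderiv ℝ F) (x, φ x) :=
    (C.hasFDerivAt.comp _ hF.fderiv.differentiableAt.hasFDerivAt).fderiv
  refine analyticAt_of_implicit (g := fun p => C (fderiv ℝ F p)) ?_ hg (fun v hv => hnd v ?_) hφ ?_
  · rw [← (LinearMap.toContinuousLinearMap (𝕜 := ℝ) (E := Y) (F' := ℝ)).finrank_eq]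
    exact (Subspace.dual_finrank_eq).symm
  · intro h
    rw [hd] at hv
    rw [← hC, ← ContinuousLinearMap.comp_apply, hv]
    rfl
  · filter_upwards [hcrit] with x' hzero
    ext h
    rw [hC, hzero]
    rfl

/-- Envelope theorem: the first derivative of a value function. -/
theorem eventually_fderiv_value_eq {F : X × Y → ℝ} {x : X} {φ : X → Y}
    (hF : AnalyticAt ℝ F (x, φ x)) (hφ : AnalyticAt ℝ φ x)
    (hcrit : ∀ᶠ x' in 𝓝 x, ∀ h, fderiv ℝ F (x', φ x') (0, h) = 0) :
    ∀ᶠ x' in 𝓝 x, ∀ v, fderiv ℝ (fun x => F (x, φ x)) x' v = fderiv ℝ F (x', φ x') (v, 0) := by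
  have hc : ContinuousAt (fun x' => (x', φ x')) x := continuousAt_id.prodMk hφ.continuousAt
  filter_upwards [hcrit, hφ.eventually_analyticAt, hc.eventually hF.eventually_analyticAt]
    with x' h1 h2 h3 v
  have h4 : HasFDerivAt (fun x' => (x', φ x')) ((ContinuousLinearMap.id ℝ X).prod (fderiv ℝ φ x')) x' :=
    (hasFDerivAt_id x').prodMk h2.differentiableAt.hasFDerivAt
  have h5 := (h3.differentiableAt.hasFDerivAt.comp x' h4).fderiv
  change fderiv ℝ (F ∘ fun x => (x, φ x)) x' v = _
  rw [h5]
  have h6 : (v, fderiv ℝ φ x' v) = (v, (0 : Y)) + ((0 : X), fderiv ℝ φ x' v) := by simp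
  simp only [ContinuousLinearMap.comp_apply, ContinuousLinearMap.prod_apply,
    ContinuousLinearMap.id_apply]
  rw [h6, map_add, h1, add_zero]

/-- Envelope theorem: the second derivative of a value function. -/
theorem fderiv_fderiv_value_eq {F : X × Y → ℝ} {x : X} {φ : X → Y}
    (hF : AnalyticAt ℝ F (x, φ x)) (hφ : AnalyticAt ℝ φ x)
    (hcrit : ∀ᶠ x' in 𝓝 x, ∀ h, fderiv ℝ F (x', φ x') (0, h) = 0) (w : X) :
    (∀ v, fderiv ℝ (fderiv ℝ (fun x => F (x, φ x))) x w v
      = fderiv ℝ (fderiv ℝ F) (x, φ x) (w, fderiv ℝ φ x w) (v, 0)) ∧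
    ∀ h, fderiv ℝ (fderiv ℝ F) (x, φ x) (w, fderiv ℝ φ x w) (0, h) = 0 := by
  have hc : HasFDerivAt (fun x' => (x', φ x')) ((ContinuousLinearMap.id ℝ X).prod (fderiv ℝ φ x)) x :=
    (hasFDerivAt_id x).prodMk hφ.differentiableAt.hasFDerivAt
  have hd : ∀ q : X × Y, HasFDerivAt (fun x' => fderiv ℝ F (x', φ x') q)
      (((ContinuousLinearMap.apply ℝ ℝ q) ∘L fderiv ℝ (fderiv ℝ F) (x, φ x)) ∘L
        ((ContinuousLinearMap.id ℝ X).prod (fderiv ℝ φ x))) x := fun q =>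
    HasFDerivAt.comp (g := fun p => fderiv ℝ F p q) x
      (((ContinuousLinearMap.apply ℝ ℝ q).hasFDerivAt).comp _
        hF.fderiv.differentiableAt.hasFDerivAt) hc
  constructor
  · intro v
    have hα : AnalyticAt ℝ (fun x => F (x, φ x)) x :=
      AnalyticAt.fun_comp (f := fun x => (x, φ x)) hF (analyticAt_id.prod hφ)
    have h1 : HasFDerivAt (fun x' => fderiv ℝ (fun x => F (x, φ x)) x' v)
        ((ContinuousLinearMap.apply ℝ ℝ v) ∘L fderiv ℝ (fderiv ℝ (fun x => F (x, φ x))) x) x :=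
      ((ContinuousLinearMap.apply ℝ ℝ v).hasFDerivAt).comp _
        hα.fderiv.differentiableAt.hasFDerivAt
    have h2 : (fun x' => fderiv ℝ (fun x => F (x, φ x)) x' v)
        =ᶠ[𝓝 x] fun x' => fderiv ℝ F (x', φ x') (v, 0) := by
      filter_upwards [eventually_fderiv_value_eq hF hφ hcrit] with x' hx' using hx' v
    have h3 := h1.unique ((hd (v, 0)).congr_of_eventuallyEq h2)
    simpa using DFunLike.congr_fun h3 w
  · intro h
    have h2 : (fun x' => fderiv ℝ F (x', φ x') (0, h)) =ᶠ[𝓝 x] fun _ => 0 := by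
      filter_upwards [hcrit] with x' hx' using hx' h
    have h3 := ((hasFDerivAt_const (0 : ℝ) x).congr_of_eventuallyEq h2).unique (hd (0, h))
    simpa using (DFunLike.congr_fun h3 w).symm

end Envelope

/-! ### Hessian blocks in coordinates and the Schur complement -/

section Coordinates

theorem lineDeriv_lineDeriv_eq {E : Type*} [NormedAddCommGroup E] [NormedSpace ℝ E] {F : E → ℝ}
    {p : E} (hF : AnalyticAt ℝ F p) (a b : E) :
    lineDeriv ℝ (fun q => lineDeriv ℝ F q a) p b = fderiv ℝ (fderiv ℝ F) p b a := by
  have h1 : (fun q => lineDeriv ℝ F q a) =ᶠ[𝓝 p] fun q => fderiv ℝ F q a := by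
    filter_upwards [hF.eventually_analyticAt] with q hq
    exact hq.differentiableAt.lineDeriv_eq_fderiv
  have h2 : HasFDerivAt (fun q => fderiv ℝ F q a)
      ((ContinuousLinearMap.apply ℝ ℝ a) ∘L fderiv ℝ (fderiv ℝ F) p) p :=
    ((ContinuousLinearMap.apply ℝ ℝ a).hasFDerivAt).comp _ hF.fderiv.differentiableAt.hasFDerivAt
  rw [h1.lineDeriv_eq, (h2.hasLineDerivAt b).lineDeriv]
  rfl

variable {X Y : Type*} [NormedAddCommGroup X] [NormedSpace ℝ X] [NormedAddCommGroup Y]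
  [NormedSpace ℝ Y]

/-- Both sides differentiate the same function of one real variable, so no differentiability is
required and the rewriting may be done inside iterated partial derivatives. -/
theorem lineDeriv_left (F : X × Y → ℝ) (x : X) (y : Y) (a : X) :
    lineDeriv ℝ (fun x => F (x, y)) x a = lineDeriv ℝ F (x, y) (a, 0) := by
  simp [lineDeriv]

theorem lineDeriv_right (F : X × Y → ℝ) (x : X) (y : Y) (b : Y) :
    lineDeriv ℝ (fun y => F (x, y)) y b = lineDeriv ℝ F (x, y) (0, b) := by
  simp [lineDeriv]

variable {m m' : ℕ} {F : EuclideanSpace ℝ (Fin m) × EuclideanSpace ℝ (Fin m') → ℝ}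
  {x : EuclideanSpace ℝ (Fin m)} {y : EuclideanSpace ℝ (Fin m')}

theorem hessian_apply {g : EuclideanSpace ℝ (Fin m) → ℝ} (hg : AnalyticAt ℝ g x) (j l : Fin m) :
    hessian g x j l
      = fderiv ℝ (fderiv ℝ g) x (EuclideanSpace.single l 1) (EuclideanSpace.single j 1) :=
  lineDeriv_lineDeriv_eq hg _ _

theorem hessian_left_apply (hF : AnalyticAt ℝ F (x, y)) (j l : Fin m) :
    hessian (fun x => F (x, y)) x j l = fderiv ℝ (fderiv ℝ F) (x, y)
      (EuclideanSpace.single l 1, 0) (EuclideanSpace.single j 1, 0) := by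
  rw [← lineDeriv_lineDeriv_eq hF, ← lineDeriv_left]
  simp only [← lineDeriv_left]
  rfl

theorem hessian_right_apply (hF : AnalyticAt ℝ F (x, y)) (j l : Fin m') :
    hessian (fun y => F (x, y)) y j l = fderiv ℝ (fderiv ℝ F) (x, y)
      (0, EuclideanSpace.single l 1) (0, EuclideanSpace.single j 1) := by
  rw [← lineDeriv_lineDeriv_eq hF, ← lineDeriv_right]
  simp only [← lineDeriv_right]
  rfl

theorem hessianMixed_apply (hF : AnalyticAt ℝ F (x, y)) (j : Fin m) (l : Fin m') :
    hessianMixed (fun x y => F (x, y)) x y j l = fderiv ℝ (fderiv ℝ F) (x, y)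
      (0, EuclideanSpace.single l 1) (EuclideanSpace.single j 1, 0) := by
  rw [← lineDeriv_lineDeriv_eq hF, ← lineDeriv_right]
  simp only [← lineDeriv_left]
  rfl

theorem sum_smul_single (v : EuclideanSpace ℝ (Fin m)) :
    v = ∑ i, v i • EuclideanSpace.single i (1 : ℝ) := by
  have := (EuclideanSpace.basisFun (Fin m) ℝ).sum_repr v
  simpa using this.symm

theorem inr_sum_smul_single (v : EuclideanSpace ℝ (Fin m')) :
    ((0 : EuclideanSpace ℝ (Fin m)), v)
      = ∑ i, v i • ((0 : EuclideanSpace ℝ (Fin m)), EuclideanSpace.single i (1 : ℝ)) := by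
  have h := congrArg (ContinuousLinearMap.inr ℝ (EuclideanSpace ℝ (Fin m)) _) (sum_smul_single v)
  simpa only [map_sum, map_smul, ContinuousLinearMap.inr_apply] using h

theorem isSymm_fderiv_fderiv {E : Type*} [NormedAddCommGroup E] [NormedSpace ℝ E] {g : E → ℝ}
    {p : E} (hg : AnalyticAt ℝ g p) (a b : E) :
    fderiv ℝ (fderiv ℝ g) p a b = fderiv ℝ (fderiv ℝ g) p b a :=
  (hg.contDiffAt (n := ω)).isSymmSndFDerivAt (by simp) a b

/-- Turns nonsingularity of the Hessian matrix into the nondegeneracy hypothesis of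
`analyticAt_criticalPoint`. -/
theorem eq_zero_of_isUnit_hessian (hF : AnalyticAt ℝ F (x, y))
    (hu : IsUnit (hessian (fun y => F (x, y)) y)) (v : EuclideanSpace ℝ (Fin m'))
    (hv : ∀ h, fderiv ℝ (fderiv ℝ F) (x, y) (0, v) (0, h) = 0) : v = 0 := by
  have h1 : hessian (fun y => F (x, y)) y *ᵥ v.ofLp = 0 := by
    ext j
    have h2 := hv (EuclideanSpace.single j 1)
    rw [inr_sum_smul_single v] at h2
    simp only [map_sum, map_smul, smul_apply, sum_apply, smul_eq_mul] at h2
    simp only [Matrix.mulVec, dotProduct, hessian_right_apply hF, Pi.zero_apply]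
    rw [← h2]
    exact Finset.sum_congr rfl fun i _ => mul_comm _ _
  have h3 := (Matrix.mulVec_injective_of_isUnit hu) (h1.trans (Matrix.mulVec_zero _).symm)
  exact (WithLp.ofLp_injective 2) h3

/-- Hessian of the value function of a parametric nondegenerate critical point. -/
theorem hessian_value_eq {φ : EuclideanSpace ℝ (Fin m) → EuclideanSpace ℝ (Fin m')}
    (hF : AnalyticAt ℝ F (x, φ x)) (hφ : AnalyticAt ℝ φ x)
    (hcrit : ∀ᶠ x' in 𝓝 x, ∀ h, fderiv ℝ F (x', φ x') (0, h) = 0)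
    (hu : IsUnit (hessian (fun y => F (x, y)) (φ x))) :
    hessian (fun x => F (x, φ x)) x = hessian (fun x' => F (x', φ x)) x -
      hessianMixed (fun x y => F (x, y)) x (φ x) * (hessian (fun y => F (x, y)) (φ x))⁻¹ *
        (hessianMixed (fun x y => F (x, y)) x (φ x))ᵀ := by
  have hα : AnalyticAt ℝ (fun x => F (x, φ x)) x :=
    AnalyticAt.fun_comp (f := fun x => (x, φ x)) hF (analyticAt_id.prod hφ)
  -- `P` is the Jacobian of `φ` at `x`.
  let P : Matrix (Fin m') (Fin m) ℝ :=
    Matrix.of fun i l => fderiv ℝ φ x (EuclideanSpace.single l 1) i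
  set B := fderiv ℝ (fderiv ℝ F) (x, φ x) with hB
  have hdecomp : ∀ (l : Fin m) q,
      B (EuclideanSpace.single l 1, fderiv ℝ φ x (EuclideanSpace.single l 1)) q
        = B (EuclideanSpace.single l 1, 0) q
          + ∑ i, P i l * B (0, EuclideanSpace.single i 1) q := by
    intro l q
    have h1 : (EuclideanSpace.single l (1 : ℝ), fderiv ℝ φ x (EuclideanSpace.single l 1))
        = (EuclideanSpace.single l (1 : ℝ), (0 : EuclideanSpace ℝ (Fin m')))
          + (0, fderiv ℝ φ x (EuclideanSpace.single l 1)) := by simp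
    rw [h1, inr_sum_smul_single, map_add, add_apply, map_sum, sum_apply]
    simp only [map_smul, smul_apply, smul_eq_mul, P, Matrix.of_apply]
  have h1 : hessian (fun x => F (x, φ x)) x = hessian (fun x' => F (x', φ x)) x
      + hessianMixed (fun x y => F (x, y)) x (φ x) * P := by
    ext j l
    rw [hessian_apply hα, (fderiv_fderiv_value_eq hF hφ hcrit _).1, hdecomp, Matrix.add_apply,
      hessian_left_apply hF, Matrix.mul_apply]
    simp only [hessianMixed_apply hF]
    congr 1
    exact Finset.sum_congr rfl fun i _ => mul_comm _ _
  -- The critical point equation, differentiated along the branch, in matrix form; it is solved for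
  -- `P` next.
  have h2 : (hessianMixed (fun x y => F (x, y)) x (φ x))ᵀ
      + hessian (fun y => F (x, y)) (φ x) * P = 0 := by
    ext i l
    have h3 := (fderiv_fderiv_value_eq hF hφ hcrit (EuclideanSpace.single l 1)).2
      (EuclideanSpace.single i 1)
    rw [hdecomp, isSymm_fderiv_fderiv hF] at h3
    rw [Matrix.add_apply, Matrix.transpose_apply, Matrix.mul_apply, hessianMixed_apply hF,
      Matrix.zero_apply, ← h3]
    simp only [hessian_right_apply hF]
    congr 1
    exact Finset.sum_congr rfl fun i _ => mul_comm _ _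
  have h4 : P = -((hessian (fun y => F (x, y)) (φ x))⁻¹ *
      (hessianMixed (fun x y => F (x, y)) x (φ x))ᵀ) := by
    rw [eq_neg_of_add_eq_zero_left h2, Matrix.mul_neg, neg_neg, ← Matrix.mul_assoc,
      Matrix.nonsing_inv_mul _ ((Matrix.isUnit_iff_isUnit_det _).1 hu), Matrix.one_mul]
  rw [h1, h4, Matrix.mul_neg, ← sub_eq_add_neg, Matrix.mul_assoc]

end Coordinates

/-! ### Regularity, coercivity and derivative of `σ^𝒱` -/

section RedSigma

variable {d n : ℕ} {A : EuclideanSpace ℝ (Fin d) → Matrix (Fin n) (Fin n) ℂ}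
  {𝒱 : Submodule ℂ (EuclideanSpace ℂ (Fin n))} {x : EuclideanSpace ℝ (Fin d)} {z : ℂ}

theorem redMatrix_apply {k : ℕ} (V : Matrix (Fin n) (Fin k) ℂ) (x : EuclideanSpace ℝ (Fin d))
    (z : ℂ) (i : Fin n) (j : Fin k) :
    redMatrix A V x z i j = (A x * V) i j - z * V i j := by
  simp [redMatrix]

theorem analyticAt_mul_apply {k : ℕ} (hA : ∀ i j, AnalyticAt ℝ (fun x => A x i j) x)
    (V : Matrix (Fin n) (Fin k) ℂ) (i : Fin n) (j : Fin k) :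
    AnalyticAt ℝ (fun x => (A x * V) i j) x := by
  simp only [Matrix.mul_apply]
  exact Finset.analyticAt_fun_sum _ fun l _ => (hA i l).mul analyticAt_const

theorem analyticAt_redMatrix {k : ℕ} (hA : ∀ i j, AnalyticAt ℝ (fun x => A x i j) x)
    (V : Matrix (Fin n) (Fin k) ℂ) (z : ℂ) (i : Fin n) (j : Fin k) :
    AnalyticAt ℝ (fun p : EuclideanSpace ℝ (Fin d) × ℂ => redMatrix A V p.1 p.2 i j) (x, z) := by
  simp only [redMatrix_apply]
  refine AnalyticAt.sub ?_ (analyticAt_snd.mul analyticAt_const)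
  exact AnalyticAt.fun_comp (g := fun x => (A x * V) i j)
    (f := fun p : EuclideanSpace ℝ (Fin d) × ℂ => p.1) (analyticAt_mul_apply hA V i j)
    analyticAt_fst

theorem analyticAt_redSigma (hA : ∀ i j, AnalyticAt ℝ (fun x => A x i j) x)
    (hs : SigmaMinSimple (redMatrix A (basisMatrix 𝒱) x z)) (hpos : 0 < redSigma A 𝒱 x z) :
    AnalyticAt ℝ (fun p : EuclideanSpace ℝ (Fin d) × ℂ => redSigma A 𝒱 p.1 p.2) (x, z) :=
  analyticAt_sigmaMin (M := fun p : EuclideanSpace ℝ (Fin d) × ℂ =>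
    redMatrix A (basisMatrix 𝒱) p.1 p.2) (fun i j => analyticAt_redMatrix hA _ z i j) hs hpos

theorem eventually_continuousAt_redSigma (hA : ∀ i j, AnalyticAt ℝ (fun x => A x i j) x) :
    ∀ᶠ x' in 𝓝 x, ∀ z, ContinuousAt (Function.uncurry (redSigma A 𝒱)) (x', z) := by
  have h1 : ∀ᶠ x' in 𝓝 x, ∀ i j, AnalyticAt ℝ (fun x => A x i j) x' := by
    rw [eventually_all]; intro i
    rw [eventually_all]; intro j
    exact (hA i j).eventually_analyticAt
  filter_upwards [h1] with x' hx' z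
  refine ContinuousAt.comp (g := sigmaMin)
    (f := fun p : EuclideanSpace ℝ (Fin d) × ℂ => redMatrix A (basisMatrix 𝒱) p.1 p.2)
    continuous_sigmaMin.continuousAt ?_
  exact continuousAt_pi.2 fun i => continuousAt_pi.2 fun j =>
    (analyticAt_redMatrix hx' _ z i j).continuousAt

/-- For a unit `w ∈ 𝒱` attaining the minimum, `‖z‖ = ‖z • w‖ ≤ ‖A w - z • w‖ + ‖A w‖ ≤ ε + ‖A‖`, and
`‖A(x')‖` is bounded near `x`. -/
theorem exists_bound_of_redSigma_le (hA : ∀ i j, AnalyticAt ℝ (fun x => A x i j) x)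
    (hk : 0 < Module.finrank ℂ 𝒱) (ε : ℝ) :
    ∃ R, ∀ᶠ x' in 𝓝 x, ∀ z, redSigma A 𝒱 x' z ≤ ε → ‖z‖ ≤ R := by
  let Φ : Matrix (Fin n) (Fin n) ℂ →ₗ[ℂ] (EuclideanSpace ℂ (Fin n) →L[ℂ] EuclideanSpace ℂ (Fin n)) :=
    (Matrix.toEuclideanLin.trans LinearMap.toContinuousLinearMap).toLinearMap
  have hΦ : Continuous Φ := Φ.continuous_of_finiteDimensional
  have hAc : ContinuousAt A x :=
    continuousAt_pi.2 fun i => continuousAt_pi.2 fun j => (hA i j).continuousAt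
  have hc : ContinuousAt (fun x' => ‖Φ (A x')‖) x := (hΦ.continuousAt.comp hAc).norm
  refine ⟨ε + (‖Φ (A x)‖ + 1), ?_⟩
  filter_upwards [hc.eventually_lt_const (lt_add_one _)] with x' hx' z hz
  obtain ⟨v, hv, hv'⟩ := (isLeast_sigmaMin hk (redMatrix A (basisMatrix 𝒱) x' z)).1
  set w := Matrix.toEuclideanLin (basisMatrix 𝒱) v with hw
  have hw1 : ‖w‖ = 1 := by rw [hw, (isBasisMatrix_basisMatrix 𝒱).norm_toEuclideanLin, hv]
  have h1 : Matrix.toEuclideanLin (redMatrix A (basisMatrix 𝒱) x' z) v = Φ (A x') w - z • w := by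
    ext i
    simp [redMatrix, Matrix.toEuclideanLin, Φ, hw]
  have h2 : ‖z • w‖ = ‖z‖ := by rw [norm_smul, hw1, mul_one]
  have h3 : ‖z • w‖ ≤ ‖Φ (A x') w - z • w‖ + ‖Φ (A x') w‖ := by
    have := norm_sub_le (Φ (A x') w) (Φ (A x') w - z • w)
    rw [sub_sub_cancel] at this
    linarith
  have h4 : ‖Φ (A x') w‖ ≤ ‖Φ (A x')‖ := by
    have := (Φ (A x')).le_opNorm w
    rwa [hw1, mul_one] at this
  have h5 : ‖Φ (A x') w - z • w‖ ≤ ε := by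
    rw [← h1, hv']; exact hz
  linarith

/-- The derivative of the reduced smallest singular value in terms of a consistent pair of singular
vectors. -/
theorem fderiv_redSigma_eq (hA : ∀ i j, AnalyticAt ℝ (fun x => A x i j) x)
    (hS : AnalyticAt ℝ (fun p : EuclideanSpace ℝ (Fin d) × ℂ => redSigma A 𝒱 p.1 p.2) (x, z))
    (hpos : 0 < redSigma A 𝒱 x z) {k : ℕ} (hk : 0 < k) {V : Matrix (Fin n) (Fin k) ℂ}
    (hV : IsBasisMatrix V 𝒱) {u : Fin n → ℂ} {v : Fin k → ℂ}
    (huv : IsConsistentPair (redMatrix A V x z) u v) (h : EuclideanSpace ℝ (Fin d)) (w : ℂ) :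
    fderiv ℝ (fun p : EuclideanSpace ℝ (Fin d) × ℂ => redSigma A 𝒱 p.1 p.2) (x, z) (h, w) =
      (star u ⬝ᵥ (Matrix.of fun a b => lineDeriv ℝ (fun x' => (A x' * V) a b) x h) *ᵥ v
        - w * (star u ⬝ᵥ V *ᵥ v)).re := by
  have h1 : HasDerivAt (fun t : ℝ => sigmaMin (redMatrix A V (x + t • h) (z + t • w)))
      (fderiv ℝ (fun p : EuclideanSpace ℝ (Fin d) × ℂ => redSigma A 𝒱 p.1 p.2) (x, z) (h, w)) 0 := by
    have := hS.differentiableAt.hasFDerivAt.hasLineDerivAt (h, w)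
    simpa only [HasLineDerivAt, ← redSigma_eq A 𝒱 hV] using! this
  have h2 : ∀ i j, HasDerivAt (fun t : ℝ => redMatrix A V (x + t • h) (z + t • w) i j)
      ((Matrix.of (fun a b => lineDeriv ℝ (fun x' => (A x' * V) a b) x h) - w • V) i j) 0 := by
    intro i j
    simp only [redMatrix_apply]
    have h3 : HasDerivAt (fun t : ℝ => (A (x + t • h) * V) i j)
        (lineDeriv ℝ (fun x' => (A x' * V) i j) x h) 0 :=
      (analyticAt_mul_apply hA V i j).differentiableAt.lineDifferentiableAt.hasLineDerivAt
    have h4 : HasDerivAt (fun t : ℝ => z + t • w) w 0 := by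
      simpa using ((hasDerivAt_id (0 : ℝ)).smul_const w).const_add z
    exact h3.sub (h4.mul_const (V i j))
  have h5 := hasDerivAt_sigmaMin_eq h2 hk
    (by simpa [← redSigma_eq A 𝒱 hV] using hpos) h1 (by simpa using huv)
  rw [h5, Matrix.sub_mulVec, dotProduct_sub, Matrix.smul_mulVec, dotProduct_smul, smul_eq_mul]

end RedSigma

/-! ### First derivatives of the Lagrangian and the multiplier -/

section LagrangianCalculus

variable {d n : ℕ} {A : EuclideanSpace ℝ (Fin d) → Matrix (Fin n) (Fin n) ℂ}
  {𝒱 : Submodule ℂ (EuclideanSpace ℂ (Fin n))} {ε : ℝ} {x : EuclideanSpace ℝ (Fin d)} {z : ℂ}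
  {y : EuclideanSpace ℝ (Fin 3)} {μ : ℝ}

/-- The projection `(z₁, z₂, μ) ↦ z₁ + i z₂`. -/
noncomputable def complexPart : EuclideanSpace ℝ (Fin 3) →L[ℝ] ℂ :=
  (EuclideanSpace.proj 0 : EuclideanSpace ℝ (Fin 3) →L[ℝ] ℝ).smulRight (1 : ℂ) +
    (EuclideanSpace.proj 1 : EuclideanSpace ℝ (Fin 3) →L[ℝ] ℝ).smulRight Complex.I

theorem complexPart_apply (y : EuclideanSpace ℝ (Fin 3)) : complexPart y = ⟨y 0, y 1⟩ := by
  apply Complex.ext <;> simp [complexPart]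

theorem complexPart_mkY (z : ℂ) (μ : ℝ) : complexPart (mkY z μ) = z := by
  rw [complexPart_apply]; apply Complex.ext <;> simp [mkY]

theorem lagrangian_mkY : lagrangian A 𝒱 ε x (mkY z μ) = z.re - μ * (redSigma A 𝒱 x z - ε) := by
  rw [lagrangian, ← complexPart_apply, complexPart_mkY]
  simp [mkY]

theorem analyticAt_lagrangian
    (hS : AnalyticAt ℝ (fun p : EuclideanSpace ℝ (Fin d) × ℂ => redSigma A 𝒱 p.1 p.2)
      (x, complexPart y)) :
    AnalyticAt ℝ (fun p : EuclideanSpace ℝ (Fin d) × EuclideanSpace ℝ (Fin 3) =>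
      lagrangian A 𝒱 ε p.1 p.2) (x, y) := by
  simp only [lagrangian, ← complexPart_apply]
  have hc : ∀ i : Fin 3, AnalyticAt ℝ (fun p : EuclideanSpace ℝ (Fin d) × EuclideanSpace ℝ (Fin 3)
      => p.2 i) (x, y) := fun i =>
    ((EuclideanSpace.proj i : EuclideanSpace ℝ (Fin 3) →L[ℝ] ℝ).analyticAt _).fun_comp
      analyticAt_snd
  have h1 : AnalyticAt ℝ (fun p : EuclideanSpace ℝ (Fin d) × EuclideanSpace ℝ (Fin 3) =>
      redSigma A 𝒱 p.1 (complexPart p.2)) (x, y) :=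
    AnalyticAt.fun_comp (g := fun p : EuclideanSpace ℝ (Fin d) × ℂ => redSigma A 𝒱 p.1 p.2)
      (f := fun p : EuclideanSpace ℝ (Fin d) × EuclideanSpace ℝ (Fin 3) =>
        (p.1, complexPart p.2)) hS
      (analyticAt_fst.prod ((complexPart.analyticAt _).fun_comp analyticAt_snd))
  exact (hc 0).sub ((hc 2).mul (h1.sub analyticAt_const))

theorem fderiv_lagrangian_apply
    (hS : AnalyticAt ℝ (fun p : EuclideanSpace ℝ (Fin d) × ℂ => redSigma A 𝒱 p.1 p.2)
      (x, complexPart y)) (a : EuclideanSpace ℝ (Fin d)) (h : EuclideanSpace ℝ (Fin 3)) :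
    fderiv ℝ (fun p : EuclideanSpace ℝ (Fin d) × EuclideanSpace ℝ (Fin 3) =>
      lagrangian A 𝒱 ε p.1 p.2) (x, y) (a, h)
      = h 0 - (h 2 * (redSigma A 𝒱 x (complexPart y) - ε) + y 2 *
        fderiv ℝ (fun p : EuclideanSpace ℝ (Fin d) × ℂ => redSigma A 𝒱 p.1 p.2)
          (x, complexPart y) (a, complexPart h)) := by
  have h1 := (analyticAt_lagrangian (ε := ε) hS).differentiableAt.hasFDerivAt.hasLineDerivAt (a, h)
  refine h1.unique ?_
  have h2 : HasDerivAt (fun t : ℝ => redSigma A 𝒱 (x + t • a) (complexPart (y + t • h)))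
      (fderiv ℝ (fun p : EuclideanSpace ℝ (Fin d) × ℂ => redSigma A 𝒱 p.1 p.2)
          (x, complexPart y) (a, complexPart h)) 0 := by
    have := hS.differentiableAt.hasFDerivAt.hasLineDerivAt (a, complexPart h)
    simpa only [HasLineDerivAt, map_add, map_smul] using! this
  have hc : ∀ i : Fin 3, HasDerivAt (fun t : ℝ => (y + t • h) i) (h i) 0 := fun i => by
    simpa using ((hasDerivAt_id (0 : ℝ)).mul_const (h i)).const_add (y i)
  have h3 := (hc 0).sub ((hc 2).mul (h2.sub_const ε))
  simpa only [HasLineDerivAt, zero_smul, add_zero, lagrangian, ← complexPart_apply] using! h3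

theorem pderiv_lagrangian_right
    (hS : AnalyticAt ℝ (fun p : EuclideanSpace ℝ (Fin d) × ℂ => redSigma A 𝒱 p.1 p.2)
      (x, complexPart y)) (j : Fin 3) :
    pderiv j (lagrangian A 𝒱 ε x) y
      = fderiv ℝ (fun p : EuclideanSpace ℝ (Fin d) × EuclideanSpace ℝ (Fin 3) =>
          lagrangian A 𝒱 ε p.1 p.2) (x, y) (0, EuclideanSpace.single j 1) := by
  rw [← (analyticAt_lagrangian (ε := ε) hS).differentiableAt.lineDeriv_eq_fderiv, ← lineDeriv_right]
  rfl

/-- For `μ = 0` the Lagrangian reduces to `z₁`, whose derivative is `1`. -/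
theorem IsMultiplier.ne_zero (h : IsMultiplier A 𝒱 ε x z μ) : μ ≠ 0 := by
  rintro rfl
  have h1 := h.2.1
  simp [pderiv, lineDeriv, lagrangian, mkY] at h1

theorem IsMultiplier.redSigma_eq_eps (h : IsMultiplier A 𝒱 ε x z μ) : redSigma A 𝒱 x z = ε := by
  have := (mul_eq_zero.1 h.2.2.2).resolve_left h.ne_zero
  linarith

/-- The stationarity equations in terms of `σ`; the first shows that `μ` is determined as
`1/σ_{z₁}`. -/
theorem IsMultiplier.fderiv_redSigma
    (hS : AnalyticAt ℝ (fun p : EuclideanSpace ℝ (Fin d) × ℂ => redSigma A 𝒱 p.1 p.2) (x, z))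
    (h : IsMultiplier A 𝒱 ε x z μ) :
    μ * fderiv ℝ (fun p : EuclideanSpace ℝ (Fin d) × ℂ => redSigma A 𝒱 p.1 p.2) (x, z) (0, 1) = 1 ∧
    fderiv ℝ (fun p : EuclideanSpace ℝ (Fin d) × ℂ => redSigma A 𝒱 p.1 p.2) (x, z)
      (0, Complex.I) = 0 := by
  have hS' : AnalyticAt ℝ (fun p : EuclideanSpace ℝ (Fin d) × ℂ => redSigma A 𝒱 p.1 p.2)
      (x, complexPart (mkY z μ)) := by rwa [complexPart_mkY]
  have h0 := h.2.1
  have h1 := h.2.2.1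
  have e0 : complexPart (EuclideanSpace.single 0 1) = 1 := by
    rw [complexPart_apply]; apply Complex.ext <;> simp
  have e1 : complexPart (EuclideanSpace.single 1 1) = Complex.I := by
    rw [complexPart_apply]; apply Complex.ext <;> simp
  rw [pderiv_lagrangian_right hS', fderiv_lagrangian_apply hS', complexPart_mkY] at h0 h1
  rw [e0] at h0
  rw [e1] at h1
  simp [mkY] at h0 h1
  exact ⟨by linarith, h1.resolve_left h.ne_zero⟩

end LagrangianCalculus

/-! ### The analytic branch of primal-dual solutions -/

section ValueFunction

variable {d n : ℕ} {A : EuclideanSpace ℝ (Fin d) → Matrix (Fin n) (Fin n) ℂ}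
  {𝒱 : Submodule ℂ (EuclideanSpace ℂ (Fin n))} {ε : ℝ} {x : EuclideanSpace ℝ (Fin d)} {z : ℂ}
  {μ : ℝ}

theorem continuous_mkY : Continuous fun p : ℂ × ℝ => mkY p.1 p.2 := by
  refine (PiLp.continuous_toLp 2 _).comp (continuous_pi fun i => ?_)
  fin_cases i <;> simp <;> fun_prop

theorem eventually_redSigma_sub_lt
    (hS : AnalyticAt ℝ (fun p : EuclideanSpace ℝ (Fin d) × ℂ => redSigma A 𝒱 p.1 p.2) (x, z))
    (hD : 0 < fderiv ℝ (fun p : EuclideanSpace ℝ (Fin d) × ℂ => redSigma A 𝒱 p.1 p.2) (x, z) (0, 1)) :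
    ∀ᶠ t : ℝ in 𝓝[>] 0, redSigma A 𝒱 x (z - t) < redSigma A 𝒱 x z := by
  have hneg : fderiv ℝ (fun p : EuclideanSpace ℝ (Fin d) × ℂ => redSigma A 𝒱 p.1 p.2) (x, z)
      (-(0, 1)) < 0 := by
    rw [map_neg]; linarith
  filter_upwards [eventually_lt_of_hasFDerivAt_neg hS.differentiableAt.hasFDerivAt hneg] with t ht
  simpa [← sub_eq_add_neg] using ht

/-- Near a nondegenerate point the primal-dual optimal point is an analytic function of the
parameter, it is critical for the Lagrangian, and the value of the Lagrangian at it is the reduced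
pseudospectral abscissa, which is attained. -/
theorem exists_analyticAt_primalDual (hA : ∀ i j, AnalyticAt ℝ (fun x => A x i j) x)
    (hS : AnalyticAt ℝ (fun p : EuclideanSpace ℝ (Fin d) × ℂ => redSigma A 𝒱 p.1 p.2) (x, z))
    (hk : 0 < Module.finrank ℂ 𝒱) (hopt : IsOptimal A 𝒱 ε x z)
    (huniq : ∀ w, IsOptimal A 𝒱 ε x w → w = z) (hμ : IsMultiplier A 𝒱 ε x z μ)
    (hunit : IsUnit (hessian (lagrangian A 𝒱 ε x) (mkY z μ))) :
    ∃ φ : EuclideanSpace ℝ (Fin d) → EuclideanSpace ℝ (Fin 3),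
      φ x = mkY z μ ∧ AnalyticAt ℝ φ x ∧
      (∀ᶠ x' in 𝓝 x, ∀ h,
        fderiv ℝ (fun p : EuclideanSpace ℝ (Fin d) × EuclideanSpace ℝ (Fin 3) =>
          lagrangian A 𝒱 ε p.1 p.2) (x', φ x') (0, h) = 0) ∧
      ∀ᶠ x' in 𝓝 x, IsGreatest (Complex.re '' redPseudospectrum A 𝒱 ε x')
        (lagrangian A 𝒱 ε x' (φ x')) := by
  classical
  set S := fun p : EuclideanSpace ℝ (Fin d) × ℂ => redSigma A 𝒱 p.1 p.2 with hSdef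
  obtain ⟨hD1, -⟩ := hμ.fderiv_redSigma hS
  have hDpos : 0 < fderiv ℝ S (x, z) (0, 1) := by
    by_contra hneg
    have := mul_nonpos_of_nonneg_of_nonpos hμ.1 (not_lt.1 hneg)
    linarith
  have hσ := hμ.redSigma_eq_eps
  obtain ⟨R, hR⟩ := exists_bound_of_redSigma_le hA hk ε
  obtain ⟨hex, hnear⟩ := exists_maximizer_near (s := redSigma A 𝒱) (x₀ := x) (z₀ := z)
    (eventually_continuousAt_redSigma hA) hR hopt.2
    (fun w hw hwz => huniq w ⟨hw, fun w' hw' => (hopt.2 w' hw').trans hwz.ge⟩)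
    (by simpa only [hσ] using eventually_redSigma_sub_lt hS hDpos)
  change ∀ᶠ x' in 𝓝 x, ∃ z', IsOptimal A 𝒱 ε x' z' at hex
  change ∀ N ∈ 𝓝 z, ∀ᶠ x' in 𝓝 x, ∀ z', IsOptimal A 𝒱 ε x' z' → z' ∈ N at hnear
  -- Any choice of maximizer works, since all of them are close to `z`; the default value is never
  -- taken near `x`.
  let Z : EuclideanSpace ℝ (Fin d) → ℂ := fun x' =>
    if h : ∃ z', IsOptimal A 𝒱 ε x' z' then h.choose else z
  have hZ : ∀ x', (∃ z', IsOptimal A 𝒱 ε x' z') → IsOptimal A 𝒱 ε x' (Z x') := fun x' h => by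
    simp only [Z, dif_pos h]; exact h.choose_spec
  have hZx : Z x = z := huniq _ (hZ x ⟨z, hopt⟩)
  have hZc : ContinuousAt Z x := by
    rw [ContinuousAt, hZx]
    refine tendsto_def.2 fun N hN => ?_
    filter_upwards [hnear N hN, hex] with x' h1 h2 using h1 _ (hZ x' h2)
  have hpc : ContinuousAt (fun x' => (x', Z x')) x := continuousAt_id.prodMk hZc
  have hSx : AnalyticAt ℝ S (x, Z x) := by rwa [hZx]
  have hDc : ContinuousAt (fun x' => fderiv ℝ S (x', Z x') (0, 1)) x :=
    (ContinuousAt.comp (g := fderiv ℝ S) (f := fun x' => (x', Z x'))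
      hSx.fderiv.continuousAt hpc).clm_apply continuousAt_const
  -- The last coordinate is the only multiplier compatible with stationarity in `z₁`.
  let φ : EuclideanSpace ℝ (Fin d) → EuclideanSpace ℝ (Fin 3) := fun x' =>
    mkY (Z x') (fderiv ℝ S (x', Z x') (0, 1))⁻¹
  have hφx : φ x = mkY z μ := by
    simp only [φ, hZx]
    rw [eq_inv_of_mul_eq_one_left hD1]
  have hφc : ContinuousAt φ x :=
    ContinuousAt.comp (g := fun p : ℂ × ℝ => mkY p.1 p.2)
      (f := fun x' => (Z x', (fderiv ℝ S (x', Z x') (0, 1))⁻¹)) continuous_mkY.continuousAt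
      (hZc.prodMk (hDc.inv₀ (by rw [hZx]; exact hDpos.ne')))
  have hkkt : ∀ᶠ x' in 𝓝 x, AnalyticAt ℝ S (x', Z x') ∧ 0 < fderiv ℝ S (x', Z x') (0, 1) ∧
      IsOptimal A 𝒱 ε x' (Z x') ∧ redSigma A 𝒱 x' (Z x') = ε ∧
      fderiv ℝ S (x', Z x') (0, Complex.I) = 0 := by
    filter_upwards [hex, hpc.eventually hSx.eventually_analyticAt,
      hDc.eventually_const_lt (u := 0) (by simpa only [hZx] using hDpos)] with x' h1 h2 h3
    have h4 := hZ x' h1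
    have h5 : HasFDerivAt (redSigma A 𝒱 x')
        (fderiv ℝ S (x', Z x') ∘L ContinuousLinearMap.inr ℝ _ ℂ) (Z x') :=
      HasFDerivAt.comp (g := S) (f := fun w : ℂ => (x', w)) (Z x')
        h2.differentiableAt.hasFDerivAt (hasFDerivAt_prodMk_right x' (Z x'))
    obtain ⟨h6, h7⟩ := eq_and_deriv_I_eq_zero_of_maximizer h5 h4.1 h4.2
    exact ⟨h2, h3, h4, h6, by simpa using h7⟩
  have hcrit : ∀ᶠ x' in 𝓝 x, ∀ h,
      fderiv ℝ (fun p : EuclideanSpace ℝ (Fin d) × EuclideanSpace ℝ (Fin 3) =>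
        lagrangian A 𝒱 ε p.1 p.2) (x', φ x') (0, h) = 0 := by
    filter_upwards [hkkt] with x' ⟨h1, h2, h3, h4, h5⟩ h
    have h6 : complexPart (φ x') = Z x' := complexPart_mkY _ _
    rw [fderiv_lagrangian_apply (by rwa [h6]), h6, h4]
    have h7 : ((0 : EuclideanSpace ℝ (Fin d)), complexPart h)
        = h 0 • ((0 : EuclideanSpace ℝ (Fin d)), (1 : ℂ)) + h 1 • (0, Complex.I) := by
      ext1
      · simp
      · rw [complexPart_apply]; apply Complex.ext <;> simp
    have h8 : φ x' 2 = (fderiv ℝ S (x', Z x') (0, 1))⁻¹ := by simp [φ, mkY]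
    rw [h7, map_add, map_smul, map_smul, h5, h8, smul_eq_mul, smul_zero, add_zero]
    field_simp
    ring
  have hF : AnalyticAt ℝ (fun p : EuclideanSpace ℝ (Fin d) × EuclideanSpace ℝ (Fin 3) =>
      lagrangian A 𝒱 ε p.1 p.2) (x, φ x) :=
    analyticAt_lagrangian (by rw [hφx, complexPart_mkY]; exact hS)
  refine ⟨φ, hφx, ?_, hcrit, ?_⟩
  · refine analyticAt_criticalPoint hF hφc hcrit (eq_zero_of_isUnit_hessian hF ?_)
    rw [hφx]; exact hunit
  · filter_upwards [hkkt] with x' ⟨h1, h2, h3, h4, h5⟩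
    have h6 : lagrangian A 𝒱 ε x' (φ x') = (Z x').re := by
      rw [lagrangian_mkY, h4]; ring
    rw [h6]
    refine ⟨⟨Z x', h3.1, rfl⟩, ?_⟩
    rintro _ ⟨w, hw, rfl⟩
    exact h3.2 w hw

end ValueFunction

/-! ### Entries of the Hessian blocks of the Lagrangian -/

section Entries

variable {d n : ℕ} {A : EuclideanSpace ℝ (Fin d) → Matrix (Fin n) (Fin n) ℂ}
  {𝒱 : Submodule ℂ (EuclideanSpace ℂ (Fin n))} {ε : ℝ} {x : EuclideanSpace ℝ (Fin d)} {z : ℂ}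
  {μ : ℝ}

theorem pderiv_const_mul {m : ℕ} (j : Fin m) (c : ℝ) (g : EuclideanSpace ℝ (Fin m) → ℝ)
    (x : EuclideanSpace ℝ (Fin m)) : pderiv j (fun x => c * g x) x = c * pderiv j g x := by
  simp only [pderiv, lineDeriv]
  exact deriv_const_mul_field _

theorem pderiv_lagrangian_left (j : Fin d) (y : EuclideanSpace ℝ (Fin 3)) :
    pderiv j (fun x' => lagrangian A 𝒱 ε x' y) x
      = -y 2 * pderiv j (fun x' => redSigma A 𝒱 x' ⟨y 0, y 1⟩) x := by
  rw [← pderiv_const_mul]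
  simp only [pderiv, lineDeriv, lagrangian, deriv_const_sub, mul_sub, deriv_sub_const, neg_mul,
    deriv.fun_neg]

theorem hessian_lagrangian_left_apply (j l : Fin d) :
    hessian (fun x' => lagrangian A 𝒱 ε x' (mkY z μ)) x j l
      = -μ * pderiv₂ j l (fun x' => redSigma A 𝒱 x' z) x := by
  rw [pderiv₂, ← pderiv_const_mul]
  change pderiv l (pderiv j fun x' => lagrangian A 𝒱 ε x' (mkY z μ)) x = _
  congr 1
  funext x'
  rw [pderiv_lagrangian_left]
  rfl

theorem hessianMixed_lagrangian_castSucc (j : Fin d) (l : Fin 2) :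
    hessianMixed (lagrangian A 𝒱 ε) x (mkY z μ) j l.castSucc
      = -μ * pderivMixed j l (redSigmaReal A 𝒱) x !₂[z.re, z.im] := by
  simp only [hessianMixed, Matrix.of_apply, pderivMixed, pderiv_lagrangian_left]
  rw [← pderiv_const_mul]
  simp only [redSigmaReal]
  -- Only where this `x`-derivative is evaluated matters, so it may be an arbitrary function of `(a,
  -- b)`; differentiability in `z` plays no role.
  generalize (fun a b : ℝ => pderiv j (fun x' => redSigma A 𝒱 x' ⟨a, b⟩) x) = G
  simp only [pderiv, lineDeriv]
  congr 1
  funext t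
  fin_cases l <;> simp [mkY]

theorem hessianMixed_lagrangian_last (j : Fin d) :
    hessianMixed (lagrangian A 𝒱 ε) x (mkY z μ) j (Fin.last 2)
      = -pderiv j (fun x' => redSigma A 𝒱 x' z) x := by
  simp only [hessianMixed, Matrix.of_apply, pderivMixed, pderiv_lagrangian_left]
  -- Moving in the last direction changes only `μ`, on which the `x`-derivative of the Lagrangian
  -- depends linearly.
  have h : ∀ t : ℝ, (mkY z μ + t • EuclideanSpace.single (Fin.last 2) (1 : ℝ)) = mkY z (μ + t) := by
    intro t
    ext i
    fin_cases i <;> simp [mkY, Fin.last]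
  rw [pderiv, lineDeriv]
  simp only [h]
  change deriv (fun t : ℝ => -(μ + t) * pderiv j (fun x' => redSigma A 𝒱 x' z) x) 0 = _
  simp

theorem hessian_lagrangian_right_apply
    (hS : AnalyticAt ℝ (fun p : EuclideanSpace ℝ (Fin d) × ℂ => redSigma A 𝒱 p.1 p.2) (x, z))
    (j l : Fin 3) :
    hessian (lagrangian A 𝒱 ε x) (mkY z μ) j l
      = -pderiv₂ j l (fun y => y 2 * redSigma A 𝒱 x ⟨y 0, y 1⟩) (mkY z μ) := by
  let H : EuclideanSpace ℝ (Fin 3) → ℝ := fun y => y 2 * redSigma A 𝒱 x ⟨y 0, y 1⟩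
  -- The part `z₁ + ε μ` of the Lagrangian is linear, hence invisible to second derivatives; only
  -- `-μ σ` remains.
  let ℓ : EuclideanSpace ℝ (Fin 3) →L[ℝ] ℝ := EuclideanSpace.proj 0 + ε • EuclideanSpace.proj 2
  have hL : lagrangian A 𝒱 ε x = fun y => ℓ y - H y := by
    funext y; simp [lagrangian, H, ℓ]; ring
  have hLa : AnalyticAt ℝ (lagrangian A 𝒱 ε x) (mkY z μ) :=
    AnalyticAt.fun_comp (f := fun y => (x, y))
      (analyticAt_lagrangian (ε := ε) (y := mkY z μ) (by rwa [complexPart_mkY]))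
      (analyticAt_const.prod analyticAt_id)
  have hH : AnalyticAt ℝ H (mkY z μ) := by
    have h1 : H = fun y => ℓ y - lagrangian A 𝒱 ε x y := by funext y; rw [hL]; ring
    rw [h1]
    exact (ℓ.analyticAt _).sub hLa
  have h1 : pderiv j (lagrangian A 𝒱 ε x) =ᶠ[𝓝 (mkY z μ)]
      fun y => ℓ (EuclideanSpace.single j 1) - pderiv j H y := by
    filter_upwards [hH.eventually_analyticAt] with y hy
    rw [hL]
    exact ((ℓ.hasFDerivAt.hasLineDerivAt _).sub
      (hy.differentiableAt.lineDifferentiableAt.hasLineDerivAt)).deriv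
  change pderiv l (pderiv j (lagrangian A 𝒱 ε x)) (mkY z μ) = -pderiv l (pderiv j H) (mkY z μ)
  rw [pderiv, h1.lineDeriv_eq]
  simp only [lineDeriv, pderiv, deriv_const_sub]

end Entries

/-! ### Gradient formula and assembly of the theorem -/

theorem matrixFunction_analyticAt {d n κ : ℕ} {f : Fin κ → EuclideanSpace ℝ (Fin d) → ℝ}
    {A : Fin κ → Matrix (Fin n) (Fin n) ℂ} {x : EuclideanSpace ℝ (Fin d)}
    (hf : ∀ i, AnalyticAt ℝ (f i) x) (a b : Fin n) :
    AnalyticAt ℝ (fun x => matrixFunction f A x a b) x := by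
  simp only [matrixFunction, Matrix.sum_apply, Matrix.smul_apply]
  exact Finset.analyticAt_fun_sum _ fun i _ => (hf i).smul analyticAt_const

/-- The gradient of the reduced pseudospectral abscissa and the multiplier in terms of singular
vectors. -/
theorem gradient_of_isConsistentPair {d n : ℕ}
    {A : EuclideanSpace ℝ (Fin d) → Matrix (Fin n) (Fin n) ℂ}
    {𝒱 : Submodule ℂ (EuclideanSpace ℂ (Fin n))} {ε : ℝ} {x : EuclideanSpace ℝ (Fin d)} {z : ℂ}
    {μ : ℝ} (hε : 0 < ε) (hA : ∀ i j, AnalyticAt ℝ (fun x => A x i j) x)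
    (hS : AnalyticAt ℝ (fun p : EuclideanSpace ℝ (Fin d) × ℂ => redSigma A 𝒱 p.1 p.2) (x, z))
    (hk : 0 < Module.finrank ℂ 𝒱) (hμ : IsMultiplier A 𝒱 ε x z μ) {α : EuclideanSpace ℝ (Fin d) → ℝ}
    (hα : DifferentiableAt ℝ α x)
    (hαd : ∀ v, fderiv ℝ α x v
      = -(μ * fderiv ℝ (fun p : EuclideanSpace ℝ (Fin d) × ℂ => redSigma A 𝒱 p.1 p.2) (x, z) (v, 0)))
    {k : ℕ} {V : Matrix (Fin n) (Fin k) ℂ} {u : Fin n → ℂ} {v : Fin k → ℂ}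
    (hV : IsBasisMatrix V 𝒱) (huv : IsConsistentPair (redMatrix A V x z) u v) :
    star u ⬝ᵥ V *ᵥ v ≠ 0 ∧
      HasGradientAt α (WithLp.toLp 2 fun j =>
        ((star u ⬝ᵥ pderivMatrix j (fun x' => A x' * V) x *ᵥ v) / (star u ⬝ᵥ V *ᵥ v)).re) x ∧
      (μ : ℂ) = -1 / (star u ⬝ᵥ V *ᵥ v) := by
  have hkk : 0 < k := by
    have : Module.finrank ℂ 𝒱 = k := by
      rw [← hV.2, finrank_span_eq_card hV.1.linearIndependent, Fintype.card_fin]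
    omega
  have hD := fderiv_redSigma_eq hA hS (hμ.redSigma_eq_eps ▸ hε) hkk hV huv
  obtain ⟨h1, h2⟩ := hμ.fderiv_redSigma hS
  set c := star u ⬝ᵥ V *ᵥ v with hc
  rw [hD] at h1 h2
  -- The directions `1` and `i` in the `z`-plane give `-μ Re c = 1` and `Im c = 0`.
  have hμc : (μ : ℂ) * c = -1 := by
    have hzero : (Matrix.of fun a b => lineDeriv ℝ (fun x' => (A x' * V) a b) x
        (0 : EuclideanSpace ℝ (Fin d))) = 0 := by
      ext a b; simp [lineDeriv_zero]
    rw [hzero] at h1 h2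
    simp at h1 h2
    apply Complex.ext
    · simp; linarith
    · simp [h2]
  have hcne : c ≠ 0 := by
    intro h0
    rw [h0, mul_zero] at hμc
    norm_num at hμc
  have hμeq : (μ : ℂ) = -1 / c := by rw [eq_div_iff hcne, hμc]
  refine ⟨hcne, ?_, hμeq⟩
  rw [hasGradientAt_iff_hasFDerivAt]
  suffices h : InnerProductSpace.toDual ℝ (EuclideanSpace ℝ (Fin d)) (WithLp.toLp 2 fun j =>
      ((star u ⬝ᵥ pderivMatrix j (fun x' => A x' * V) x *ᵥ v) / c).re) = fderiv ℝ α x by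
    rw [h]; exact hα.hasFDerivAt
  apply ContinuousLinearMap.coe_injective
  refine (EuclideanSpace.basisFun (Fin d) ℝ).toBasis.ext fun j => ?_
  simp only [OrthonormalBasis.coe_toBasis, EuclideanSpace.basisFun_apply,
    ContinuousLinearMap.coe_coe, InnerProductSpace.toDual_apply_apply]
  rw [hαd, hD, EuclideanSpace.inner_single_right]
  have h3 : ∀ w : ℂ, (w / c).re = -(μ * w.re) := fun w => by
    have : w / c = -((μ : ℂ) * w) := by rw [hμeq]; ring
    rw [this]; simp
  simp [h3, pderivMatrix]

end PSA

end

theorem theorem2p5 {d n κ : ℕ} (Ω : Set (EuclideanSpace ℝ (Fin d))) (hΩ : IsOpen Ω)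
    (f : Fin κ → EuclideanSpace ℝ (Fin d) → ℝ) (hf : ∀ i, AnalyticOnNhd ℝ (f i) Ω)
    (A : Fin κ → Matrix (Fin n) (Fin n) ℂ) (ε : ℝ) (hε : 0 < ε)
    (𝒱 : Submodule ℂ (EuclideanSpace ℂ (Fin n))) (x : EuclideanSpace ℝ (Fin d)) (hx : x ∈ Ω)
    (hnd : PSA.IsNondegenerate (PSA.matrixFunction f A) 𝒱 ε x) :
    -- near `x` the maximum that defines the reduced pseudospectral abscissa is attained
    (∀ᶠ x' in nhds x, IsGreatest
      (Complex.re '' PSA.redPseudospectrum (PSA.matrixFunction f A) 𝒱 ε x')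
      (PSA.redAbscissa (PSA.matrixFunction f A) 𝒱 ε x')) ∧
    AnalyticAt ℝ (PSA.redAbscissa (PSA.matrixFunction f A) 𝒱 ε) x ∧
    ∀ (z : ℂ) (μ : ℝ), PSA.IsOptimal (PSA.matrixFunction f A) 𝒱 ε x z →
      PSA.IsMultiplier (PSA.matrixFunction f A) 𝒱 ε x z μ →
      -- the gradient and the multiplier, for every orthonormal basis matrix `V` of `𝒱` and every
      -- consistent pair of singular vectors
      (∀ (k : ℕ) (V : Matrix (Fin n) (Fin k) ℂ) (u : Fin n → ℂ) (v : Fin k → ℂ),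
        PSA.IsBasisMatrix V 𝒱 →
        PSA.IsConsistentPair (PSA.redMatrix (PSA.matrixFunction f A) V x z) u v →
          star u ⬝ᵥ V *ᵥ v ≠ 0 ∧
          HasGradientAt (PSA.redAbscissa (PSA.matrixFunction f A) 𝒱 ε)
            (WithLp.toLp 2 fun j =>
              ((star u ⬝ᵥ PSA.pderivMatrix j (fun x' => PSA.matrixFunction f A x' * V) x *ᵥ v) /
                (star u ⬝ᵥ V *ᵥ v)).re) x ∧
          (μ : ℂ) = -1 / (star u ⬝ᵥ V *ᵥ v)) ∧
      -- the Hessian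
      PSA.hessian (PSA.redAbscissa (PSA.matrixFunction f A) 𝒱 ε) x =
        PSA.hessian
            (fun x' => PSA.lagrangian (PSA.matrixFunction f A) 𝒱 ε x' (PSA.mkY z μ)) x -
          PSA.hessianMixed (PSA.lagrangian (PSA.matrixFunction f A) 𝒱 ε) x (PSA.mkY z μ) *
            (PSA.hessian (PSA.lagrangian (PSA.matrixFunction f A) 𝒱 ε x) (PSA.mkY z μ))⁻¹ *
            (PSA.hessianMixed (PSA.lagrangian (PSA.matrixFunction f A) 𝒱 ε) x (PSA.mkY z μ))ᵀ ∧
      -- the entries of the three blocks of the Hessian of the Lagrangian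
      (∀ j l : Fin d,
        PSA.hessian
            (fun x' => PSA.lagrangian (PSA.matrixFunction f A) 𝒱 ε x' (PSA.mkY z μ)) x j l =
          -μ * PSA.pderiv₂ j l (fun x' => PSA.redSigma (PSA.matrixFunction f A) 𝒱 x' z) x) ∧
      (∀ (j : Fin d) (l : Fin 2),
        PSA.hessianMixed (PSA.lagrangian (PSA.matrixFunction f A) 𝒱 ε) x (PSA.mkY z μ) j
            l.castSucc =
          -μ * PSA.pderivMixed j l (PSA.redSigmaReal (PSA.matrixFunction f A) 𝒱) x
            !₂[z.re, z.im]) ∧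
      (∀ j : Fin d,
        PSA.hessianMixed (PSA.lagrangian (PSA.matrixFunction f A) 𝒱 ε) x (PSA.mkY z μ) j
            (Fin.last 2) =
          -PSA.pderiv j (fun x' => PSA.redSigma (PSA.matrixFunction f A) 𝒱 x' z) x) ∧
      (∀ j l : Fin 3,
        PSA.hessian (PSA.lagrangian (PSA.matrixFunction f A) 𝒱 ε x) (PSA.mkY z μ) j l =
          -PSA.pderiv₂ j l
            (fun y => y 2 * PSA.redSigma (PSA.matrixFunction f A) 𝒱 x ⟨y 0, y 1⟩)
            (PSA.mkY z μ)) := by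
  have hA := PSA.matrixFunction_analyticAt (A := A) fun i => hf i x hx
  obtain ⟨z₀, μ₀, hopt, huniq, hsimple, hμ₀, hunit⟩ := hnd
  -- From here on only the analyticity of the entries of `A(·)` is used.
  generalize PSA.matrixFunction f A = A' at *
  have hs₀ := hsimple _ _ (PSA.isBasisMatrix_basisMatrix 𝒱)
  have hk := hs₀.pos
  have hS := PSA.analyticAt_redSigma hA hs₀ (hμ₀.redSigma_eq_eps ▸ hε)
  obtain ⟨φ, hφx, hφ, hcrit, hgreat⟩ :=
    PSA.exists_analyticAt_primalDual hA hS hk hopt huniq hμ₀ hunit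
  have hα : PSA.redAbscissa A' 𝒱 ε =ᶠ[nhds x] fun x' => PSA.lagrangian A' 𝒱 ε x' (φ x') := by
    filter_upwards [hgreat] with x' hx' using hx'.csSup_eq
  have hS' : AnalyticAt ℝ (fun p : EuclideanSpace ℝ (Fin d) × ℂ => PSA.redSigma A' 𝒱 p.1 p.2)
      (x, PSA.complexPart (φ x)) := by rwa [hφx, PSA.complexPart_mkY]
  have hF := PSA.analyticAt_lagrangian (ε := ε) hS'
  have hval : AnalyticAt ℝ (fun x' => PSA.lagrangian A' 𝒱 ε x' (φ x')) x :=
    AnalyticAt.fun_comp (f := fun x => (x, φ x)) hF (analyticAt_id.prod hφ)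
  have hαa : AnalyticAt ℝ (PSA.redAbscissa A' 𝒱 ε) x := hval.congr hα.symm
  refine ⟨?_, hαa, ?_⟩
  · filter_upwards [hgreat, hα] with x' h1 h2
    rwa [h2]
  intro z μ hz hμ
  obtain rfl := huniq z hz
  -- Both multipliers are the inverse of `σ_{z₁}`, so the nonsingularity assumed for `μ₀` applies to
  -- `μ`.
  obtain rfl : μ = μ₀ := by
    rw [eq_inv_of_mul_eq_one_left (hμ.fderiv_redSigma hS).1,
      eq_inv_of_mul_eq_one_left (hμ₀.fderiv_redSigma hS).1]
  refine ⟨?_, ?_, PSA.hessian_lagrangian_left_apply, PSA.hessianMixed_lagrangian_castSucc,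
    PSA.hessianMixed_lagrangian_last, PSA.hessian_lagrangian_right_apply hS⟩
  · intro k V u v hV huv
    refine PSA.gradient_of_isConsistentPair hε hA hS hk hμ hαa.differentiableAt (fun w => ?_) hV huv
    have h1 := (PSA.eventually_fderiv_value_eq hF hφ hcrit).self_of_nhds w
    rw [hα.fderiv_eq, h1, PSA.fderiv_lagrangian_apply hS', hφx, PSA.complexPart_mkY]
    simp [PSA.mkY]
  · have h1 := PSA.hessian_value_eq hF hφ hcrit (by rw [hφx]; exact hunit)
    rw [hφx] at h1
    rw [← h1]
    ext j l
    rw [PSA.hessian_apply hαa, PSA.hessian_apply hval, hα.fderiv.fderiv_eq]
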